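/- Let $d\in\mathbb N$, $r>0$, let $D\subset[0,r]^d$ be compact and convex, and let $K(x,x')=k(\|x-x'\|_2/l)$ be an isotropic kernel with lengthscale $l>0$ and $|k(\rho)|\le k(0)=\sigma_f^2\le\sigma_{\max}^2$ for all $\rho\ge 0$. Let $f$ be a sample of a Gaussian process on $D$ with mean zero and covariance $K$, whose sample paths are almost surely differentiable on $D$ and satisfy, for some constants $a,b>0$, $$\Pr\Big\{\sup_{x\in D}|\partial f/\partial x_j|>L\Big\}\le a e^{-(L/b)^2},\qquad j=1,\dots,d,\ L>0 ,$$ and let $x^*\in D$ be a minimizer of $f$ on $D$. Let $\delta\in(0,1)$ and $$\beta_t=2\log\frac{2t^2\pi^2}{3\delta}+2d\log\Big(t^2dbr\sqrt{\log(4da/\delta)}\Big).$$ (Conventions: $\log 0=0$, and $\sqrt s=0$ for $s<0$.) For points $X=(x_1,\dots,x_{t-1})$ with noise-free outputs $y=(f(x_1),\dots,f(x_{t-1}))$ write $\mu_{t-1}(x)=K_{xX}K_{XX}^{-1}y$ and $\sigma_{t-1}^2(x)=K_{xx}-K_{xX}K_{XX}^{-1}K_{Xx}$. At iteration $t\ge1$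 let $\tilde k$ be the piecewise-linear interpolant of $k$ with $M_t$ pieces, at breakpoints $0=R_0<\dots<R_{M_t}$ with $R_{M_t}\ge\|x-x'\|_2/l$ for all $x,x'\in D$, and let $|k-\tilde k|\le\epsilon_{M_t}$ on $[0,R_{M_t}]$. Write $\tilde K,\tilde\mu_{t-1},\tilde\sigma_{t-1}$ for the same objects with $\tilde k$ in place of $k$ (a negative approximated variance is replaced by $0$). Let $x_t\in D$ be the $x$-component of an optimal solution of the approximated LCB problem at iteration $t$, $$\min_{x\in D,\,\tilde\mu,\,\tilde\sigma}\ \tilde\mu-\beta_t^{1/2}\tilde\sigma\quad\text{s.t.}\quad \tilde\mu=\tilde\mu_{t-1}(x),\ \ \tilde\sigma^2\le\tilde\sigma_{t-1}^2(x),$$ chosen as a measurable function of the past outputs $f(x_1),\dots,f(x_{t-1})$. Then there is an event of probability at least $1-\delta$ on which, simultaneously for all $t\ge1$, the instantaneous regret $r_t=f(x_t)-f(x^*)$ satisfies $$r_t\le 2\beta_t^{1/2}\sigma_{t-1}(x_t)+\frac1{t^2}+2C_\mu t^2\epsilon_{M_t}+4C_\sigma\beta_t^{1/2}t\,\epsilon_{M_t}^{1/2},\qquad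 C_\mu=\frac{B\,\sigma_{\max}^2}{\sigma_\epsilon^{4}},\quad C_\sigma=\frac{\sigma_{\max}^2}{\sigma_\epsilon^{2}},$$ for every $\sigma_\epsilon>0$ such that $K_{XX}$ and $\tilde K_{XX}$ are invertible with $\|K_{XX}^{-1}\|_2,\|\tilde K_{XX}^{-1}\|_2\le\sigma_\epsilon^{-2}$, and every $B\ge0$ with $|f(x_i)|\le B$ for $i<t$ (in particular $B=1$ for outputs scaled to $[0,1]$). -/

import Mathlib

open MeasureTheory ProbabilityTheory

noncomputable section

/-! ### Radial kernels and their piecewise-linear interpolants -/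

/-- The isotropic kernel `K(x, x') = k(‖x - x'‖₂ / l)` on `ℝ^d` with radial profile `k` and
lengthscale `l`. -/
def radialKernel {d : ℕ} (k : ℝ → ℝ) (l : ℝ) (x y : EuclideanSpace ℝ (Fin d)) : ℝ :=
  k (‖x - y‖ / l)

/-- The piecewise-linear interpolant of `k` with the `M` pieces given by the breakpoints
`R 0 < R 1 < ⋯ < R M`. The `j`-th summand is `0` to the left of the `j`-th piece, increases
linearly along it by `k (R (j+1)) - k (R j)`, and is constant to its right. -/
def pwlInterp {M : ℕ} (k : ℝ → ℝ) (R : Fin (M + 1) → ℝ) (ρ : ℝ) : ℝ :=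
  k (R 0) + ∑ j : Fin M,
    (k (R j.succ) - k (R j.castSucc)) / (R j.succ - R j.castSucc) *
      (max (R j.castSucc) (min ρ (R j.succ)) - R j.castSucc)

/-- Telescoping of the increments of a finite sequence. -/
theorem fin_telescope {M : ℕ} (h : Fin (M + 1) → ℝ) (i : Fin (M + 1)) :
    h 0 + ∑ j : Fin M, (if j.castSucc < i then h j.succ - h j.castSucc else 0) = h i := by
  induction i using Fin.induction with
  | zero => simp
  | succ i ih =>
    have key : ∀ j : Fin M, (if j.castSucc < i.succ then h j.succ - h j.castSucc else 0) =
        (if j.castSucc < i.castSucc then h j.succ - h j.castSucc else 0) +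
          (if j = i then h i.succ - h i.castSucc else 0) := by
      intro j
      rcases lt_trichotomy j i with hj | hj | hj
      · have h1 : j.castSucc < i.succ := Fin.castSucc_lt_succ_iff.2 hj.le
        have h2 : j.castSucc < i.castSucc := by simpa using hj
        simp [h1, h2, hj.ne]
      · subst hj
        simp
      · have h1 : ¬ j.castSucc < i.succ := by simpa [Fin.castSucc_lt_succ_iff] using hj
        have h2 : ¬ j.castSucc < i.castSucc := by simpa using hj.le
        simp [h1, h2, hj.ne']
    rw [Finset.sum_congr rfl (fun j _ => key j), Finset.sum_add_distrib, ← add_assoc, ih]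
    simp

/-- On every piece the interpolant is the chord of `k` between the two breakpoints. -/
theorem pwlInterp_eq_chord {M : ℕ} (k : ℝ → ℝ) (R : Fin (M + 1) → ℝ) (hR : StrictMono R)
    (i : Fin M) {ρ : ℝ} (h₁ : R i.castSucc ≤ ρ) (h₂ : ρ ≤ R i.succ) :
    pwlInterp k R ρ = k (R i.castSucc) +
      (k (R i.succ) - k (R i.castSucc)) / (R i.succ - R i.castSucc) * (ρ - R i.castSucc) := by
  have key : ∀ j : Fin M, (k (R j.succ) - k (R j.castSucc)) / (R j.succ - R j.castSucc) *
      (max (R j.castSucc) (min ρ (R j.succ)) - R j.castSucc) =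
      (if j.castSucc < i.castSucc then k (R j.succ) - k (R j.castSucc) else 0) +
        (if j = i then (k (R i.succ) - k (R i.castSucc)) / (R i.succ - R i.castSucc) *
          (ρ - R i.castSucc) else 0) := by
    intro j
    have hlt : R j.castSucc < R j.succ := hR (by simp [Fin.lt_def])
    rcases lt_trichotomy j i with hj | hj | hj
    · have h3 : R j.succ ≤ R i.castSucc :=
        hR.monotone (Fin.succ_le_castSucc_iff.2 hj)
      have h4 : j.castSucc < i.castSucc := by simpa using hj
      rw [min_eq_right (h3.trans h₁), max_eq_right hlt.le, if_pos h4, if_neg hj.ne,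
        div_mul_cancel₀ _ (sub_pos.2 hlt).ne', add_zero]
    · subst hj
      rw [min_eq_left h₂, max_eq_right h₁]
      simp
    · have h3 : R i.succ ≤ R j.castSucc :=
        hR.monotone (Fin.succ_le_castSucc_iff.2 hj)
      have h4 : ¬ j.castSucc < i.castSucc := by simpa using hj.le
      rw [max_eq_left ((min_le_left _ _).trans (h₂.trans h3)), if_neg h4, if_neg hj.ne']
      simp
  rw [pwlInterp, Finset.sum_congr rfl (fun j _ => key j), Finset.sum_add_distrib, ← add_assoc,
    fin_telescope (fun j => k (R j)) i.castSucc]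
  simp

/-! ### Gaussian process posteriors -/

section Posterior

variable {E : Type*} {n : ℕ}

/-- The Gram matrix `K_XX` of the data points `X`. -/
def gramMatrix (K : E → E → ℝ) (X : Fin n → E) : Matrix (Fin n) (Fin n) ℝ :=
  Matrix.of fun i j => K (X i) (X j)

/-- The vector `K_xX`. -/
def kernelVec (K : E → E → ℝ) (X : Fin n → E) (x : E) : Fin n → ℝ :=
  fun i => K x (X i)

/-- The posterior mean `K_xX K_XX⁻¹ y`. -/
def postMean (K : E → E → ℝ) (X : Fin n → E) (y : Fin n → ℝ) (x : E) : ℝ :=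
  kernelVec K X x ⬝ᵥ ((gramMatrix K X)⁻¹.mulVec y)

/-- The posterior variance `K_xx - K_xX K_XX⁻¹ K_Xx`. -/
def postVar (K : E → E → ℝ) (X : Fin n → E) (x : E) : ℝ :=
  K x x - kernelVec K X x ⬝ᵥ ((gramMatrix K X)⁻¹.mulVec (kernelVec K X x))

/-- The posterior standard deviation. For an approximated kernel, which need not be positive
semidefinite, a negative value of `postVar` is truncated to `0`. -/
def postStd (K : E → E → ℝ) (X : Fin n → E) (x : E) : ℝ :=
  Real.sqrt (postVar K X x)

/-- `K_XX` is invertible and `‖K_XX⁻¹‖₂ ≤ s⁻¹` in the spectral norm: the smallest singular value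
of `K_XX` (its smallest eigenvalue, when it is positive semidefinite) is at least `s`. -/
def WellConditioned (K : E → E → ℝ) (X : Fin n → E) (s : ℝ) : Prop :=
  IsUnit (gramMatrix K X).det ∧
    ‖Matrix.toEuclideanCLM (n := Fin n) (𝕜 := ℝ) (gramMatrix K X)⁻¹‖ ≤ s⁻¹

end Posterior

/-! ### Minimization of the approximated lower confidence bound -/

/-- The variables of the optimization model: the point `x`, its approximated posterior mean `μ` and
standard deviation `σ`, its scaled distances `ρ i` to the data points, and the approximated kernel
values `κ i` at these distances. -/
structure LCBVars (d n : ℕ) where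
  x : EuclideanSpace ℝ (Fin d)
  μ : ℝ
  σ : ℝ
  ρ : Fin n → ℝ
  κ : Fin n → ℝ

/-- The constraints of the optimization model over the domain `D`, for the radial profile `kt` of
the approximated kernel and the data `(X, y)`. The right-hand side of the variance constraint is
the approximated posterior variance, truncated at `0` as in `postStd`. -/
structure LCBFeasible {d n : ℕ} (D : Set (EuclideanSpace ℝ (Fin d))) (kt : ℝ → ℝ) (l : ℝ)
    (X : Fin n → EuclideanSpace ℝ (Fin d)) (y : Fin n → ℝ) (v : LCBVars d n) : Prop where
  mem : v.x ∈ D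
  mean_eq : v.μ = v.κ ⬝ᵥ ((gramMatrix (radialKernel kt l) X)⁻¹.mulVec y)
  var_le : v.σ ^ 2 ≤ max 0 (kt 0 - v.κ ⬝ᵥ ((gramMatrix (radialKernel kt l) X)⁻¹.mulVec v.κ))
  dist_nonneg : ∀ i, 0 ≤ v.ρ i
  dist_eq : ∀ i, v.ρ i ^ 2 = ‖v.x - X i‖ ^ 2 / l ^ 2
  kernel_eq : ∀ i, v.κ i = kt (v.ρ i)

/-- The objective `μ - β^{1/2} σ`. -/
def lcbObjective {d n : ℕ} (β : ℝ) (v : LCBVars d n) : ℝ :=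
  v.μ - Real.sqrt β * v.σ

/-- `x` is the point of an optimal solution of the optimization model. -/
def IsLCBSolution {d n : ℕ} (D : Set (EuclideanSpace ℝ (Fin d))) (kt : ℝ → ℝ) (l β : ℝ)
    (X : Fin n → EuclideanSpace ℝ (Fin d)) (y : Fin n → ℝ)
    (x : EuclideanSpace ℝ (Fin d)) : Prop :=
  ∃ v : LCBVars d n, v.x = x ∧ LCBFeasible D kt l X y v ∧
    ∀ w : LCBVars d n, LCBFeasible D kt l X y w → lcbObjective β v ≤ lcbObjective β w

/-- `f` is a centred Gaussian process on the set `D` with covariance kernel `K`, under `P`. -/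
structure IsCenteredGP {Ω E : Type*} [MeasurableSpace Ω] (P : Measure Ω) (D : Set E)
    (K : E → E → ℝ) (f : E → Ω → ℝ) : Prop where
  gaussian : IsGaussianProcess (fun (x : D) ω => f x ω) P
  mean_eq_zero : ∀ x ∈ D, ∫ ω, f x ω ∂P = 0
  cov_eq : ∀ x ∈ D, ∀ y ∈ D, cov[f x, f y; P] = K x y

/-! ### The optimization loop -/

/-- The points `x_1, …, x_{t-1}` that are available at iteration `t ≥ 1`. -/
def pastPoints {Ω E : Type*} (x : ℕ → Ω → E) (t : ℕ) (ω : Ω) : Fin (t - 1) → E :=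
  fun i => x (i + 1) ω

/-- The observations `y_i = f(x_i)`, `1 ≤ i ≤ t - 1`, that are available at iteration `t ≥ 1`. -/
def pastValues {Ω E : Type*} (f : E → Ω → ℝ) (x : ℕ → Ω → E) (t : ℕ) (ω : Ω) : Fin (t - 1) → ℝ :=
  fun i => f (x (i + 1) ω) ω

/-- `β_t = 2 log(2 t² π² / (3δ)) + 2 d log(t² d b r √(log(4 d a / δ)))`. -/
def betaSeq (d : ℕ) (a b r δ : ℝ) (t : ℕ) : ℝ :=
  2 * Real.log (2 * (t : ℝ) ^ 2 * Real.pi ^ 2 / (3 * δ)) +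
    2 * d * Real.log ((t : ℝ) ^ 2 * d * b * r * Real.sqrt (Real.log (4 * d * a / δ)))

end

/-! For a fixed design, the deviation of `f` at a point from its posterior mean is centred Gaussian
with the posterior variance and independent of the observations. The iterates are chosen from
earlier outputs, so this is needed for adaptive designs. It is transferred without conditional
distributions: on the product with an independent standard normal `Z`, the residual and `σ Z` have,
for every deterministic design, the same joint law with the outputs. Equality of these joint laws
survives when points are made functions of earlier outputs, one position at a time: for simple
functions by splitting over their values, in general by continuity in the design
(`SameDesignLaw.of_adaptive`). Residual and variance are multiplied by Gram determinants, with the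
adjugate in place of the inverse, so that continuity holds through singular designs. The Gaussian
tail then gives `measure_not_confidence_le`.

The regret needs an upper confidence bound at `x_t`, which is a function of past outputs, and a
lower one near the minimizer, which depends on the whole path. The lower bound is therefore imposed
on a finite net of `D`. Outside an event of probability `δ / 4` the partial derivatives are at most
`L = b √(log (4 d a / δ))`, and moving from the minimizer to a net point costs at most `1 / t²`.
With `τ = t² d L r ≥ 1` the net has at most `⌈τ / 2⌉ ^ d` points, and `β_t` is such that the
failures at iteration `t` have total probability at most `3 δ / (π² t²)`, which sums to `δ / 2`. If
`τ < 1`, the Lipschitz bound across `D` already gives regret at most `1 / t²`.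

The kernel error enters deterministically: the identity `A⁻¹ - B⁻¹ = A⁻¹ (B - A) B⁻¹` controls the
change of the posterior mean and variance, and optimality of `x_t` for the approximated problem
links it to the net point (`IsLCBSolution.sub_le`). -/

noncomputable section

/-! ### Equality of joint laws: from deterministic to adaptive designs -/

section AdaptiveDesign

open Filter Topology Function

variable {Ω D : Type*}

/-- The values of the field `f` at the first `n` points of the design `p`. -/
def designOutputs (f : D → Ω → ℝ) (n : ℕ) (p : ℕ → D) (ω : Ω) : Fin n → ℝ :=
  fun j => f (p j) ω

theorem designOutputs_update (f : D → Ω → ℝ) (i : ℕ) (p : ℕ → D) (q : D) (ω : Ω) :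
    designOutputs f i (update p i q) ω = designOutputs f i p ω := by
  funext j
  simp [designOutputs, update_of_ne j.2.ne]

variable [MeasurableSpace Ω]

/-- Along the random design `X`, the statistics `S` and `T` have the same joint law with the first
`n` outputs. -/
def SameDesignLaw (P : Measure Ω) (f : D → Ω → ℝ) (n : ℕ) (S T : (ℕ → D) → Ω → ℝ)
    (X : Ω → ℕ → D) : Prop :=
  P.map (fun ω => (designOutputs f n (X ω) ω, S (X ω) ω)) =
    P.map (fun ω => (designOutputs f n (X ω) ω, T (X ω) ω))

variable [MeasurableSpace D]

theorem measurable_designOutputs {f : D → Ω → ℝ} (hf : Measurable (uncurry f)) (n : ℕ)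
    {X : Ω → ℕ → D} (hX : Measurable X) :
    Measurable fun ω => designOutputs f n (X ω) ω :=
  measurable_pi_lambda _ fun j =>
    hf.comp (((measurable_pi_apply (j : ℕ)).comp hX).prodMk measurable_id)

theorem measurable_update_design {X : Ω → ℕ → D} (hX : Measurable X) (i : ℕ) {W : Ω → D}
    (hW : Measurable W) : Measurable fun ω => update (X ω) i (W ω) := by
  refine measurable_pi_lambda _ fun j => ?_
  by_cases h : j = i
  · subst h; simpa using hW
  · simpa [update_of_ne h] using (measurable_pi_iff.1 hX j)

theorem measurable_statistic {S : (ℕ → D) → Ω → ℝ} (hS : Measurable (uncurry S))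
    {X : Ω → ℕ → D} (hX : Measurable X) : Measurable fun ω => S (X ω) ω :=
  hS.comp (hX.prodMk measurable_id)

/-- Replacing one point of the design by a simple function of the previous outputs. -/
theorem SameDesignLaw.update_simpleFunc {P : Measure Ω} {f : D → Ω → ℝ}
    (hf : Measurable (uncurry f)) {S T : (ℕ → D) → Ω → ℝ} (hS : Measurable (uncurry S))
    (hT : Measurable (uncurry T)) {n i : ℕ} (hi : i ≤ n) {X : Ω → ℕ → D} (hX : Measurable X)
    (h : ∀ q, SameDesignLaw P f n S T fun ω => update (X ω) i q)
    (g : SimpleFunc (Fin i → ℝ) D) :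
    SameDesignLaw P f n S T fun ω => update (X ω) i (g (designOutputs f i (X ω) ω)) := by
  have hW : Measurable fun ω => g (designOutputs f i (X ω) ω) :=
    g.measurable.comp (measurable_designOutputs hf i hX)
  have hX' := measurable_update_design hX i hW
  have hXq : ∀ q, Measurable fun ω => update (X ω) i q := fun q =>
    measurable_update_design hX i measurable_const
  have hres : Measurable fun z : (Fin n → ℝ) × ℝ => fun j : Fin i => z.1 (Fin.castLE hi j) :=
    measurable_pi_lambda _ fun j => (measurable_pi_apply _).comp measurable_fst
  -- Where `g` takes the value `q`, the new design is the one with constant `q` at position `i`.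
  -- This event depends only on the first `i ≤ n` outputs, which the replacement does not alter, so
  -- it is visible to the joint law. Hence the need to carry the outputs along.
  have key : ∀ U : (ℕ → D) → Ω → ℝ, Measurable (uncurry U) → ∀ A : Set ((Fin n → ℝ) × ℝ),
      MeasurableSet A →
      P.map (fun ω => (designOutputs f n (update (X ω) i (g (designOutputs f i (X ω) ω))) ω,
        U (update (X ω) i (g (designOutputs f i (X ω) ω))) ω)) A =
      ∑ q ∈ g.range, P.map (fun ω => (designOutputs f n (update (X ω) i q) ω,
        U (update (X ω) i q) ω))
          (A ∩ {z | g (fun j : Fin i => z.1 (Fin.castLE hi j)) = q}) := by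
    intro U hU A hA
    have hAq : ∀ q, MeasurableSet
        (A ∩ {z : (Fin n → ℝ) × ℝ | g (fun j : Fin i => z.1 (Fin.castLE hi j)) = q}) := fun q =>
      hA.inter (hres (g.measurableSet_fiber q))
    have hmq : ∀ q, Measurable fun ω => (designOutputs f n (update (X ω) i q) ω,
        U (update (X ω) i q) ω) := fun q =>
      (measurable_designOutputs hf n (hXq q)).prodMk (measurable_statistic hU (hXq q))
    have hr : ∀ q ω, (fun j : Fin i =>
        designOutputs f n (update (X ω) i q) ω (Fin.castLE hi j)) =
          designOutputs f i (X ω) ω := by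
      intro q ω
      rw [← designOutputs_update f i (X ω) q ω]
      rfl
    rw [Measure.map_apply ((measurable_designOutputs hf n hX').prodMk
      (measurable_statistic hU hX')) hA]
    simp_rw [fun q => Measure.map_apply (μ := P) (hmq q) (hAq q)]
    rw [← measure_biUnion_finset]
    · congr 1
      ext ω
      simp only [Set.mem_preimage, Set.mem_iUnion, Set.mem_inter_iff, Set.mem_ofPred_eq, hr,
        exists_prop]
      constructor
      · intro hω
        exact ⟨_, g.mem_range_self _, hω, rfl⟩
      · rintro ⟨q, -, hω, rfl⟩
        exact hω
    · intro q _ q' _ hqq'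
      refine Set.disjoint_left.2 fun ω h1 h2 => hqq' ?_
      have h1 := h1.2
      have h2 := h2.2
      simp only [Set.mem_ofPred_eq, hr] at h1 h2
      exact h1.symm.trans h2
    · exact fun q _ => hmq q (hAq q)
  refine Measure.ext fun A hA => ?_
  rw [key S hS A hA, key T hT A hA]
  exact Finset.sum_congr rfl fun q _ => by rw [h q]

variable [MetricSpace D]

/-- Equality of laws passes to pointwise limits of designs. -/
theorem SameDesignLaw.of_tendsto {P : Measure Ω} [IsFiniteMeasure P] {f : D → Ω → ℝ}
    (hf : Measurable (uncurry f)) (hfc : ∀ ω, Continuous fun p => f p ω)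
    {S T : (ℕ → D) → Ω → ℝ} (hS : Measurable (uncurry S)) (hSc : ∀ ω, Continuous fun p => S p ω)
    (hT : Measurable (uncurry T)) (hTc : ∀ ω, Continuous fun p => T p ω) {n : ℕ}
    {X : ℕ → Ω → ℕ → D} (hX : ∀ m, Measurable (X m)) {X' : Ω → ℕ → D} (hX' : Measurable X')
    (hlim : ∀ ω, Tendsto (fun m => X m ω) atTop (𝓝 (X' ω)))
    (h : ∀ m, SameDesignLaw P f n S T (X m)) : SameDesignLaw P f n S T X' := by
  have key : ∀ U : (ℕ → D) → Ω → ℝ, Measurable (uncurry U) →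
      (∀ ω, Continuous fun p => U p ω) → ∀ φ : BoundedContinuousFunction ((Fin n → ℝ) × ℝ) ℝ,
      Tendsto (fun m => ∫ z, φ z ∂(P.map fun ω => (designOutputs f n (X m ω) ω, U (X m ω) ω)))
        atTop (𝓝 (∫ z, φ z ∂(P.map fun ω => (designOutputs f n (X' ω) ω, U (X' ω) ω)))) := by
    intro U hU hUc φ
    have hm : ∀ Y : Ω → ℕ → D, Measurable Y →
        Measurable fun ω => (designOutputs f n (Y ω) ω, U (Y ω) ω) := fun Y hY =>
      (measurable_designOutputs hf n hY).prodMk (measurable_statistic hU hY)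
    have hi : ∀ Y : Ω → ℕ → D, Measurable Y →
        ∫ z, φ z ∂(P.map fun ω => (designOutputs f n (Y ω) ω, U (Y ω) ω)) =
          ∫ ω, φ (designOutputs f n (Y ω) ω, U (Y ω) ω) ∂P := fun Y hY =>
      integral_map (hm Y hY).aemeasurable φ.continuous.measurable.aestronglyMeasurable
    simp_rw [hi _ hX', fun m => hi _ (hX m)]
    refine tendsto_integral_of_dominated_convergence (fun _ => ‖φ‖)
      (fun m => (φ.continuous.measurable.comp (hm _ (hX m))).aestronglyMeasurable)
      (integrable_const _) (fun m => ae_of_all _ fun ω => φ.norm_coe_le_norm _)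
      (ae_of_all _ fun ω => ?_)
    refine (φ.continuous.tendsto _).comp (Tendsto.prodMk_nhds ?_
      ((hUc ω).tendsto _ |>.comp (hlim ω)))
    exact tendsto_pi_nhds.2 fun j =>
      ((hfc ω).tendsto _).comp ((tendsto_pi_nhds.1 (hlim ω)) j)
  refine ext_of_forall_integral_eq_of_IsFiniteMeasure fun φ => ?_
  refine tendsto_nhds_unique (key S hS hSc φ) ?_
  have := key T hT hTc φ
  refine this.congr fun m => ?_
  rw [h m]

variable [SecondCountableTopology D] [BorelSpace D]

/-- Replacing one point of the design by a measurable function of the previous outputs. -/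
theorem SameDesignLaw.update {P : Measure Ω} [IsFiniteMeasure P] {f : D → Ω → ℝ}
    (hf : Measurable (uncurry f)) (hfc : ∀ ω, Continuous fun p => f p ω)
    {S T : (ℕ → D) → Ω → ℝ} (hS : Measurable (uncurry S)) (hSc : ∀ ω, Continuous fun p => S p ω)
    (hT : Measurable (uncurry T)) (hTc : ∀ ω, Continuous fun p => T p ω) {n i : ℕ} (hi : i ≤ n)
    {X : Ω → ℕ → D} (hX : Measurable X)
    (h : ∀ q, SameDesignLaw P f n S T fun ω => update (X ω) i q)
    {g : (Fin i → ℝ) → D} (hg : Measurable g) :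
    SameDesignLaw P f n S T fun ω => update (X ω) i (g (designOutputs f i (X ω) ω)) := by
  have hne : Nonempty D := ⟨g 0⟩
  have q₀ : D := hne.some
  have hlim : ∀ y, Tendsto (fun m => SimpleFunc.approxOn g hg Set.univ q₀ trivial m y) atTop
      (𝓝 (g y)) := fun y => SimpleFunc.tendsto_approxOn hg (Set.mem_univ _) (by simp)
  refine SameDesignLaw.of_tendsto hf hfc hS hSc hT hTc
    (X := fun m ω => Function.update (X ω) i
      (SimpleFunc.approxOn g hg Set.univ q₀ trivial m (designOutputs f i (X ω) ω)))
    (fun m => measurable_update_design hX i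
      ((SimpleFunc.measurable _).comp (measurable_designOutputs hf i hX)))
    (measurable_update_design hX i (hg.comp (measurable_designOutputs hf i hX)))
    (fun ω => tendsto_const_nhds.update i (hlim _))
    fun m => SameDesignLaw.update_simpleFunc hf hS hT hi hX h _

/-- If two statistics have the same joint law with the outputs for every deterministic design, then
also for a design whose points are chosen as measurable functions of the previous outputs. -/
theorem SameDesignLaw.of_adaptive {P : Measure Ω} [IsFiniteMeasure P] {f : D → Ω → ℝ}
    (hf : Measurable (uncurry f)) (hfc : ∀ ω, Continuous fun p => f p ω)
    {S T : (ℕ → D) → Ω → ℝ} (hS : Measurable (uncurry S)) (hSc : ∀ ω, Continuous fun p => S p ω)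
    (hT : Measurable (uncurry T)) (hTc : ∀ ω, Continuous fun p => T p ω) {n : ℕ}
    (h : ∀ p, SameDesignLaw P f n S T fun _ => p) {X : Ω → ℕ → D}
    {g : (i : ℕ) → (Fin i → ℝ) → D} (hg : ∀ i, Measurable (g i))
    (hXg : ∀ i ≤ n, ∀ ω, X ω i = g i (designOutputs f i (X ω) ω))
    {q : D} (hXq : ∀ i, n < i → ∀ ω, X ω i = q) :
    Measurable X ∧ SameDesignLaw P f n S T X := by
  -- Induction on the number of adaptive positions, for all deterministic continuations `p` at once:
  -- making position `i` adaptive requires the claim with every constant `q` there, which is the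
  -- continuation `update p i q`.
  have key : ∀ i ≤ n + 1, ∀ p : ℕ → D,
      Measurable (fun ω j => if j < i then X ω j else p j) ∧
        SameDesignLaw P f n S T fun ω j => if j < i then X ω j else p j := by
    intro i
    induction i with
    | zero => exact fun _ p => ⟨by simp, by simpa using h p⟩
    | succ i ih =>
      intro hi p
      have ih := ih (by omega)
      have hout : ∀ ω, designOutputs f i (fun j => if j < i then X ω j else p j) ω =
          designOutputs f i (X ω) ω := fun ω => by
        funext j
        simp [designOutputs]
      have heq : (fun ω j => if j < i + 1 then X ω j else p j) = fun ω =>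
          Function.update (fun j => if j < i then X ω j else p j) i
            (g i (designOutputs f i (fun j => if j < i then X ω j else p j) ω)) := by
        funext ω j
        rw [hout, ← hXg i (by omega)]
        rcases lt_trichotomy j i with hj | rfl | hj
        · simp [update_of_ne hj.ne, hj, hj.trans (Nat.lt_succ_self i)]
        · simp
        · simp [update_of_ne hj.ne', hj.not_gt, show ¬ j < i + 1 by omega]
      rw [heq]
      refine ⟨measurable_update_design (ih p).1 i
        ((hg i).comp (measurable_designOutputs hf i (ih p).1)),
        SameDesignLaw.update hf hfc hS hSc hT hTc (by omega) (ih p).1 (fun q => ?_) (hg i)⟩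
      convert (ih (Function.update p i q)).2 using 3 with ω j
      by_cases hj : j = i
      · subst hj; simp
      · simp [update_of_ne hj]
  have hX : (fun ω j => if j < n + 1 then X ω j else q) = X := by
    funext ω j
    split_ifs with hj
    · rfl
    · exact (hXq j (by omega) ω).symm
  have := key (n + 1) le_rfl fun _ => q
  rwa [hX] at this

end AdaptiveDesign

end

noncomputable section

/-! ### Law and tail of the residual scaled by the Gram determinant -/

section ScaledResidual

open Filter Topology Function Matrix

variable {Ω D : Type*}

/-- The posterior variance at `p n` given the points `p 0, …, p (n - 1)`, multiplied by the square
of the determinant of the Gram matrix. Unlike the posterior variance it depends continuously on the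
design. -/
def scaledVar (κ : D → D → ℝ) (n : ℕ) (p : ℕ → D) : ℝ :=
  (gramMatrix κ fun j : Fin n => p j).det *
    ((gramMatrix κ fun j : Fin n => p j).det * κ (p n) (p n) -
      kernelVec κ (fun j : Fin n => p j) (p n) ⬝ᵥ
        ((gramMatrix κ fun j : Fin n => p j).adjugate *ᵥ
          kernelVec κ (fun j : Fin n => p j) (p n)))

/-- The deviation of `f (p n)` from its posterior mean given the values at `p 0, …, p (n - 1)`,
multiplied by the determinant of the Gram matrix. -/
def scaledResidual (κ : D → D → ℝ) (f : D → Ω → ℝ) (n : ℕ) (p : ℕ → D) (ω : Ω) : ℝ :=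
  (gramMatrix κ fun j : Fin n => p j).det * f (p n) ω -
    kernelVec κ (fun j : Fin n => p j) (p n) ⬝ᵥ
      ((gramMatrix κ fun j : Fin n => p j).adjugate *ᵥ designOutputs f n p ω)

/-- The weights of the observations in the scaled posterior mean. -/
def scaledWeights (κ : D → D → ℝ) (n : ℕ) (p : ℕ → D) : Fin n → ℝ :=
  kernelVec κ (fun j : Fin n => p j) (p n) ᵥ* (gramMatrix κ fun j : Fin n => p j).adjugate

theorem scaledResidual_eq (κ : D → D → ℝ) (f : D → Ω → ℝ) (n : ℕ) (p : ℕ → D) (ω : Ω) :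
    scaledResidual κ f n p ω = (gramMatrix κ fun j : Fin n => p j).det * f (p n) ω -
      ∑ i, scaledWeights κ n p i * f (p i) ω := by
  rw [scaledResidual, dotProduct_mulVec]
  rfl

/-- The adjugate identity holds for singular matrices too, so no design has to be excluded in the
orthogonality below. -/
theorem scaledWeights_vecMul (κ : D → D → ℝ) (n : ℕ) (p : ℕ → D) (j : Fin n) :
    ∑ i : Fin n, scaledWeights κ n p i * κ (p i) (p j) =
      (gramMatrix κ fun j : Fin n => p j).det * κ (p n) (p j) := by
  have h : scaledWeights κ n p ᵥ* (gramMatrix κ fun j : Fin n => p j) =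
      (gramMatrix κ fun j : Fin n => p j).det • kernelVec κ (fun j : Fin n => p j) (p n) := by
    rw [scaledWeights, vecMul_vecMul, adjugate_mul, vecMul_smul, vecMul_one]
  exact congrFun h j

section Continuity

variable [TopologicalSpace D] {κ : D → D → ℝ}

theorem continuous_gramMatrix_design (hκ : Continuous (uncurry κ)) (n : ℕ) :
    Continuous fun p : ℕ → D => gramMatrix κ fun j : Fin n => p j :=
  continuous_matrix fun i j =>
    hκ.comp (Continuous.prodMk (continuous_apply (A := fun _ : ℕ => D) (i : ℕ))
      (continuous_apply (A := fun _ : ℕ => D) (j : ℕ)))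

theorem continuous_kernelVec_design (hκ : Continuous (uncurry κ)) (n : ℕ) :
    Continuous fun p : ℕ → D => kernelVec κ (fun j : Fin n => p j) (p n) :=
  continuous_pi fun j => hκ.comp
    (Continuous.prodMk (continuous_apply (A := fun _ : ℕ => D) n)
      (continuous_apply (A := fun _ : ℕ => D) (j : ℕ)))

theorem continuous_scaledVar (hκ : Continuous (uncurry κ)) (n : ℕ) :
    Continuous (scaledVar κ n) := by
  have h1 := continuous_gramMatrix_design hκ n
  have h2 := continuous_kernelVec_design hκ n
  have h3 : Continuous fun p : ℕ → D => κ (p n) (p n) :=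
    hκ.comp (Continuous.prodMk (continuous_apply (A := fun _ : ℕ => D) n)
      (continuous_apply (A := fun _ : ℕ => D) n))
  exact h1.matrix_det.mul ((h1.matrix_det.mul h3).sub
    (h2.dotProduct (h1.matrix_adjugate.matrix_mulVec h2)))

theorem continuous_scaledResidual (hκ : Continuous (uncurry κ)) {f : D → Ω → ℝ}
    (hfc : ∀ ω, Continuous fun p => f p ω) (n : ℕ) (ω : Ω) :
    Continuous fun p => scaledResidual κ f n p ω := by
  have h1 := continuous_gramMatrix_design hκ n
  have h2 := continuous_kernelVec_design hκ n
  have h3 : Continuous fun p => designOutputs f n p ω :=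
    continuous_pi fun j => (hfc ω).comp (continuous_apply (j : ℕ))
  exact (h1.matrix_det.mul ((hfc ω).comp (continuous_apply n))).sub
    (h2.dotProduct (h1.matrix_adjugate.matrix_mulVec h3))

end Continuity

variable [MeasurableSpace Ω] {P : Measure Ω} {f : D → Ω → ℝ} {κ : D → D → ℝ}

theorem measurable_scaledResidual (hf : ∀ p, Measurable (f p)) (n : ℕ) (p : ℕ → D) :
    Measurable (scaledResidual κ f n p) := by
  have : scaledResidual κ f n p = fun ω => (gramMatrix κ fun j : Fin n => p j).det * f (p n) ω -
      ∑ i, scaledWeights κ n p i * f (p i) ω := funext fun ω => scaledResidual_eq κ f n p ω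
  rw [this]
  exact ((hf _).const_mul _).sub (Finset.measurable_sum _ fun i _ => (hf _).const_mul _)

theorem covariance_scaledResidual [IsProbabilityMeasure P] (hG : IsGaussianProcess f P)
    (hcov : ∀ p q, cov[f p, f q; P] = κ p q) (n : ℕ) (p : ℕ → D) (q : D) :
    cov[scaledResidual κ f n p, f q; P] = (gramMatrix κ fun j : Fin n => p j).det * κ (p n) q -
      ∑ i, scaledWeights κ n p i * κ (p i) q := by
  have hL : ∀ x, MemLp (f x) 2 P := fun x => (hG.hasGaussianLaw_eval x).memLp_two
  have : scaledResidual κ f n p = (fun ω => (gramMatrix κ fun j : Fin n => p j).det * f (p n) ω) -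
      fun ω => ∑ i, scaledWeights κ n p i * f (p i) ω :=
    funext fun ω => scaledResidual_eq κ f n p ω
  rw [this, covariance_sub_left ((hL _).const_mul _)
    (memLp_finsetSum _ fun i _ => (hL _).const_mul _) (hL _), covariance_const_mul_left,
    covariance_fun_sum_left (fun i => (hL _).const_mul _) (hL _), hcov]
  congr 1
  exact Finset.sum_congr rfl fun i _ => by rw [covariance_const_mul_left, hcov]

/-- The normal equations of the posterior mean; joint Gaussianity turns this orthogonality into
independence. -/
theorem covariance_scaledResidual_designPoint [IsProbabilityMeasure P]
    (hG : IsGaussianProcess f P) (hcov : ∀ p q, cov[f p, f q; P] = κ p q) (n : ℕ) (p : ℕ → D)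
    (j : Fin n) : cov[scaledResidual κ f n p, f (p j); P] = 0 := by
  rw [covariance_scaledResidual hG hcov, scaledWeights_vecMul, sub_self]

theorem memLp_scaledResidual (hG : IsGaussianProcess f P) (n : ℕ) (p : ℕ → D) :
    MemLp (scaledResidual κ f n p) 2 P := by
  have hL : ∀ x, MemLp (f x) 2 P := fun x => (hG.hasGaussianLaw_eval x).memLp_two
  have : scaledResidual κ f n p = (fun ω => (gramMatrix κ fun j : Fin n => p j).det * f (p n) ω) -
      fun ω => ∑ i, scaledWeights κ n p i * f (p i) ω :=
    funext fun ω => scaledResidual_eq κ f n p ω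
  rw [this]
  exact ((hL _).const_mul _).sub (memLp_finsetSum _ fun i _ => (hL _).const_mul _)

theorem variance_scaledResidual [IsProbabilityMeasure P] (hG : IsGaussianProcess f P)
    (hcov : ∀ p q, cov[f p, f q; P] = κ p q) (n : ℕ) (p : ℕ → D) :
    Var[scaledResidual κ f n p; P] = scaledVar κ n p := by
  have hL : ∀ x, MemLp (f x) 2 P := fun x => (hG.hasGaussianLaw_eval x).memLp_two
  have hR := memLp_scaledResidual (κ := κ) hG n p
  have hsymm : ∀ x y, κ x y = κ y x := fun x y => by rw [← hcov, covariance_comm, hcov]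
  have : scaledResidual κ f n p = (fun ω => (gramMatrix κ fun j : Fin n => p j).det * f (p n) ω) -
      fun ω => ∑ i, scaledWeights κ n p i * f (p i) ω :=
    funext fun ω => scaledResidual_eq κ f n p ω
  rw [← covariance_self hR.aemeasurable]
  -- Only one of the two factors is expanded: the observations contribute nothing, being
  -- uncorrelated with the residual.
  nth_rw 2 [this]
  rw [covariance_sub_right hR ((hL _).const_mul _)
    (memLp_finsetSum _ fun i _ => (hL _).const_mul _), covariance_const_mul_right,
    covariance_fun_sum_right (fun i => (hL _).const_mul _) hR]
  simp_rw [covariance_const_mul_right, covariance_scaledResidual_designPoint hG hcov,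
    covariance_scaledResidual hG hcov]
  rw [scaledVar, dotProduct_mulVec]
  simp only [mul_zero, Finset.sum_const_zero, sub_zero]
  congr 2
  exact Finset.sum_congr rfl fun i _ => by rw [hsymm]; rfl

theorem integral_scaledResidual (hG : IsGaussianProcess f P) (hmean : ∀ p, ∫ ω, f p ω ∂P = 0)
    (n : ℕ) (p : ℕ → D) : ∫ ω, scaledResidual κ f n p ω ∂P = 0 := by
  have hI : ∀ x, Integrable (f x) P := fun x => (hG.hasGaussianLaw_eval x).integrable
  simp_rw [scaledResidual_eq]
  rw [integral_sub ((hI _).const_mul _) (integrable_finsetSum _ fun i _ => (hI _).const_mul _),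
    integral_finsetSum _ fun i _ => (hI _).const_mul _]
  simp [integral_const_mul, hmean]

/-- The pair is a linear image of the Gaussian vector of values at `p 0, …, p n`. The residual is
written as a family over `Unit` to match the criterion for independence of two jointly Gaussian
families. -/
theorem hasGaussianLaw_designOutputs_scaledResidual (hG : IsGaussianProcess f P) (n : ℕ)
    (p : ℕ → D) :
    HasGaussianLaw (fun ω => (fun j : Fin n => f (p j) ω,
      fun _ : Unit => scaledResidual κ f n p ω)) P := by
  have h := (hG.comp_right p).hasGaussianLaw (Finset.range (n + 1))
  let π : ℕ → ((Finset.range (n + 1) → ℝ) →L[ℝ] ℝ) := fun j =>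
    if hj : j ∈ Finset.range (n + 1) then ContinuousLinearMap.proj ⟨j, hj⟩ else 0
  have hπ : ∀ j ≤ n, ∀ ω, π j ((Finset.range (n + 1)).restrict fun j => (f ∘ p) j ω) =
      f (p j) ω := by
    intro j hj ω
    have : j ∈ Finset.range (n + 1) := by simp; omega
    simp only [π, this, dif_pos]
    rfl
  let L : (Finset.range (n + 1) → ℝ) →L[ℝ] (Fin n → ℝ) × (Unit → ℝ) :=
    (ContinuousLinearMap.pi fun j : Fin n => π j).prod
      (ContinuousLinearMap.pi fun _ : Unit => (gramMatrix κ fun j : Fin n => p j).det • π n -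
        ∑ i : Fin n, scaledWeights κ n p i • π i)
  have hLf : (fun ω => (fun j : Fin n => f (p j) ω, fun _ : Unit => scaledResidual κ f n p ω)) =
      fun ω => L ((Finset.range (n + 1)).restrict fun j => (f ∘ p) j ω) := by
    funext ω
    refine Prod.ext ?_ ?_
    · funext j
      simpa [L] using (hπ j j.2.le ω).symm
    · funext _
      rw [scaledResidual_eq]
      simp only [L, ContinuousLinearMap.prod_apply, ContinuousLinearMap.pi_apply,
        _root_.sub_apply, _root_.smul_apply,
        _root_.sum_apply, smul_eq_mul, hπ n le_rfl]
      congr 1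
      exact Finset.sum_congr rfl fun i _ => by rw [hπ i i.2.le]
  rw [hLf]
  exact h.map_fun L

theorem scaledVar_nonneg [IsProbabilityMeasure P] (hG : IsGaussianProcess f P)
    (hcov : ∀ p q, cov[f p, f q; P] = κ p q) (n : ℕ) (p : ℕ → D) : 0 ≤ scaledVar κ n p := by
  rw [← variance_scaledResidual hG hcov]
  exact variance_nonneg _ _

theorem map_scaledResidual [IsProbabilityMeasure P] (hG : IsGaussianProcess f P)
    (hmean : ∀ p, ∫ ω, f p ω ∂P = 0) (hcov : ∀ p q, cov[f p, f q; P] = κ p q) (n : ℕ)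
    (p : ℕ → D) :
    P.map (scaledResidual κ f n p) = gaussianReal 0 (scaledVar κ n p).toNNReal := by
  have h := ((hasGaussianLaw_designOutputs_scaledResidual (κ := κ) hG n p).snd).eval ()
  have h' := h.map_eq_gaussianReal
  rw [variance_scaledResidual hG hcov, integral_scaledResidual hG hmean] at h'
  exact h'

theorem indepFun_designOutputs_scaledResidual [IsProbabilityMeasure P]
    (hG : IsGaussianProcess f P) (hcov : ∀ p q, cov[f p, f q; P] = κ p q) (n : ℕ) (p : ℕ → D) :
    IndepFun (designOutputs f n p) (scaledResidual κ f n p) P := by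
  have h := (hasGaussianLaw_designOutputs_scaledResidual (κ := κ) hG n
    p).indepFun_of_covariance_eval (X := fun (j : Fin n) ω => f (p j) ω)
    (Y := fun (_ : Unit) ω => scaledResidual κ f n p ω) fun j _ => by
      rw [covariance_comm]
      exact covariance_scaledResidual_designPoint hG hcov n p j
  exact h.comp (φ := id) (ψ := fun y : Unit → ℝ => y ()) measurable_id (measurable_pi_apply _)

/-- The scaled residual of a deterministic design has, jointly with the outputs, the law of an
independent centred Gaussian variable. -/
theorem map_designOutputs_scaledResidual [IsProbabilityMeasure P] (hf : ∀ p, Measurable (f p))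
    (hG : IsGaussianProcess f P)
    (hmean : ∀ p, ∫ ω, f p ω ∂P = 0) (hcov : ∀ p q, cov[f p, f q; P] = κ p q) (n : ℕ)
    (p : ℕ → D) {s : ℝ} (hs : s ^ 2 = 1) :
    (P.prod (gaussianReal 0 1)).map
        (fun z => (designOutputs f n p z.1, s * scaledResidual κ f n p z.1)) =
      (P.prod (gaussianReal 0 1)).map
        (fun z => (designOutputs f n p z.1, √(scaledVar κ n p) * z.2)) := by
  have hout : Measurable (designOutputs f n p) := measurable_pi_lambda _ fun j => hf _
  -- Both sides are the product of the law of the outputs with the centred Gaussian law of variance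
  -- `scaledVar`; the sign `s` does not change the latter.
  have hres := (measurable_scaledResidual (κ := κ) hf n p).const_mul s
  have hmulR : Measurable fun z : ℝ => √(scaledVar κ n p) * z := measurable_const_mul _
  have hR : (P.prod (gaussianReal 0 1)).map
      (fun z => (designOutputs f n p z.1, √(scaledVar κ n p) * z.2)) =
      (P.map (designOutputs f n p)).prod (gaussianReal 0 (scaledVar κ n p).toNNReal) := by
    have := Measure.map_prod_map P (gaussianReal 0 1) hout hmulR
    rw [gaussianReal_map_const_mul] at this
    refine this.symm.trans ?_
    congr 2
    · simp
    · ext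
      simp [Real.sq_sqrt (scaledVar_nonneg hG hcov n p),
        Real.coe_toNNReal _ (scaledVar_nonneg hG hcov n p)]
  have hL : (P.prod (gaussianReal 0 1)).map
      (fun z => (designOutputs f n p z.1, s * scaledResidual κ f n p z.1)) =
      P.map (fun ω => (designOutputs f n p ω, s * scaledResidual κ f n p ω)) := by
    have : (fun z : Ω × ℝ => (designOutputs f n p z.1, s * scaledResidual κ f n p z.1)) =
        (fun ω => (designOutputs f n p ω, s * scaledResidual κ f n p ω)) ∘ Prod.fst := rfl
    rw [this, ← Measure.map_map (hout.prodMk hres) measurable_fst, Measure.map_fst_prod]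
    simp
  rw [hL, hR, (indepFun_iff_map_prod_eq_prod_map_map hout.aemeasurable hres.aemeasurable).1
    ((indepFun_designOutputs_scaledResidual hG hcov n p).comp (φ := id) (ψ := fun y => s * y)
      measurable_id (measurable_const_mul s))]
  congr 1
  refine (Measure.map_map (f := scaledResidual κ f n p) (g := fun y => s * y)
    (measurable_const_mul s) (measurable_scaledResidual hf n p)).symm.trans ?_
  rw [map_scaledResidual hG hmean hcov, gaussianReal_map_const_mul]
  congr 1
  · simp
  · ext; simp [hs]

/-- Chernoff's bound with the optimal exponent `c`. -/
theorem gaussianReal_Ioi_le {c : ℝ} (hc : 0 ≤ c) :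
    gaussianReal 0 1 (Set.Ioi c) ≤ ENNReal.ofReal (Real.exp (-c ^ 2 / 2)) := by
  have h := measure_ge_le_exp_mul_mgf (μ := gaussianReal 0 1) (X := id) c hc
    (integrable_exp_mul_gaussianReal c)
  rw [mgf_id_gaussianReal, ← Real.exp_add] at h
  have h2 : gaussianReal 0 1 (Set.Ioi c) ≤ gaussianReal 0 1 {y | c ≤ id y} :=
    measure_mono fun y (hy : c < y) => hy.le
  refine h2.trans ?_
  rw [← ENNReal.ofReal_toReal (measure_ne_top (gaussianReal 0 1) {y | c ≤ id y})]
  refine ENNReal.ofReal_le_ofReal (h.trans (le_of_eq ?_))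
  congr 1
  simp
  ring

variable [MetricSpace D]

/-- The kernel of a centred Gaussian process with continuous paths is continuous. -/
theorem continuous_kernel_of_continuous_paths [IsProbabilityMeasure P]
    (hf : ∀ p, Measurable (f p)) (hfc : ∀ ω, Continuous fun p => f p ω)
    (hG : IsGaussianProcess f P) (hmean : ∀ p, ∫ ω, f p ω ∂P = 0)
    (hcov : ∀ p q, cov[f p, f q; P] = κ p q) : Continuous (uncurry κ) := by
  have hL : ∀ x, MemLp (f x) 2 P := fun x => (hG.hasGaussianLaw_eval x).memLp_two
  have hsymm : ∀ x y, κ x y = κ y x := fun x y => by rw [← hcov, covariance_comm, hcov]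
  have hvar : ∀ p q, Var[fun ω => f p ω + f q ω; P] = κ p p + 2 * κ p q + κ q q := by
    intro p q
    have e : (fun ω => f p ω + f q ω) = f p + f q := rfl
    rw [e, ← covariance_self ((hL p).add (hL q)).aemeasurable,
      covariance_add_left (hL _) (hL _) ((hL _).add (hL _)),
      covariance_add_right (hL _) (hL _) (hL _), covariance_add_right (hL _) (hL _) (hL _),
      hcov, hcov, hcov, hcov, hsymm q p]
    ring
  -- The characteristic function of `f p + f q` at `1` encodes its variance. Its integrand has
  -- modulus one, so continuity follows by dominated convergence without any moment bound on the
  -- supremum of the paths.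
  have hchar : ∀ z : D × D, ∫ ω, Complex.exp ((f z.1 ω + f z.2 ω : ℝ) * Complex.I) ∂P =
      Real.exp (-(κ z.1 z.1 + 2 * κ z.1 z.2 + κ z.2 z.2) / 2) := by
    rintro ⟨p, q⟩
    have h := (hG.hasGaussianLaw_fun_add (s := p) (t := q)).map_eq_gaussianReal
    have hm : ∫ ω, f p ω + f q ω ∂P = 0 := by
      rw [integral_add (hL p |>.integrable one_le_two) (hL q |>.integrable one_le_two)]
      simp [hmean]
    rw [hvar, hm] at h
    have hc := charFun_gaussianReal (μ := 0)
      (v := (κ p p + 2 * κ p q + κ q q).toNNReal) 1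
    rw [← h, charFun_apply_real, integral_map (φ := fun ω => f p ω + f q ω)
      ((hf p).add (hf q)).aemeasurable (by fun_prop)] at hc
    have hnn : 0 ≤ κ p p + 2 * κ p q + κ q q := by
      rw [← hvar]; exact variance_nonneg _ _
    simp only [Complex.ofReal_one, one_mul, Real.coe_toNNReal _ hnn] at hc
    refine hc.trans ?_
    rw [Complex.ofReal_exp]
    congr 1
    push_cast
    ring
  have hcont : Continuous fun z : D × D =>
      ∫ ω, Complex.exp ((f z.1 ω + f z.2 ω : ℝ) * Complex.I) ∂P := by
    refine continuous_of_dominated (bound := fun _ => 1) (fun z => ?_) (fun z => ?_)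
      (integrable_const _) (ae_of_all _ fun ω => ?_)
    · have := (hf z.1).add (hf z.2)
      refine Measurable.aestronglyMeasurable ?_
      exact Complex.measurable_exp.comp ((Complex.measurable_ofReal.comp this).mul_const _)
    · exact ae_of_all _ fun ω => by rw [Complex.norm_exp_ofReal_mul_I]
    · have := ((hfc ω).comp continuous_fst).add ((hfc ω).comp (continuous_snd (X := D) (Y := D)))
      exact Complex.continuous_exp.comp ((Complex.continuous_ofReal.comp this).mul_const _)
  have hsum : Continuous fun z : D × D => κ z.1 z.1 + 2 * κ z.1 z.2 + κ z.2 z.2 := by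
    have h1 : Continuous fun z : D × D =>
        Real.log (Real.exp (-(κ z.1 z.1 + 2 * κ z.1 z.2 + κ z.2 z.2) / 2)) := by
      refine Continuous.log ?_ fun z => (Real.exp_pos _).ne'
      refine Complex.continuous_re.comp hcont |>.congr fun z => ?_
      simp only [Function.comp_apply, hchar, Complex.ofReal_re]
    simp_rw [Real.log_exp] at h1
    exact (h1.const_mul (-2)).congr fun z => by ring
  -- On the diagonal the variance of the sum is `4 κ p p`; subtracting the diagonal terms then
  -- isolates `κ p q`.
  have hdiag : Continuous fun p : D => κ p p := by
    have := hsum.comp (continuous_id.prodMk continuous_id)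
    exact (this.div_const 4).congr fun p => by simp only [Function.comp_apply, id]; ring
  have h2 := (hsum.sub ((hdiag.comp continuous_fst).add (hdiag.comp continuous_snd))).div_const 2
  exact h2.congr fun z => by simp [uncurry]

variable [SecondCountableTopology D] [MeasurableSpace D] [BorelSpace D]

/-- Tail bound for the posterior at an adaptively chosen point of a Gaussian process, given its
values at adaptively chosen points; `s = ±1` selects the upper or the lower tail. -/
theorem measure_scaledResidual_gt_le [IsProbabilityMeasure P]
    (hf : ∀ p, Measurable (f p)) (hfc : ∀ ω, Continuous fun p => f p ω)
    (hG : IsGaussianProcess f P) (hmean : ∀ p, ∫ ω, f p ω ∂P = 0)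
    (hcov : ∀ p q, cov[f p, f q; P] = κ p q) {n : ℕ} {X : Ω → ℕ → D}
    {g : (i : ℕ) → (Fin i → ℝ) → D} (hg : ∀ i, Measurable (g i))
    (hXg : ∀ i ≤ n, ∀ ω, X ω i = g i (designOutputs f i (X ω) ω))
    {q : D} (hXq : ∀ i, n < i → ∀ ω, X ω i = q) {s : ℝ} (hs : s ^ 2 = 1) {c : ℝ} (hc : 0 ≤ c) :
    P {ω | c * √(scaledVar κ n (X ω)) < s * scaledResidual κ f n (X ω) ω} ≤
      ENNReal.ofReal (Real.exp (-c ^ 2 / 2)) := by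
  have hκ := continuous_kernel_of_continuous_paths hf hfc hG hmean hcov
  -- The second coordinate is the independent standard normal. `0 < S` is the event to be bounded,
  -- and `0 < T` is its counterpart with the residual replaced by `√(scaledVar) Z`.
  let f' : D → Ω × ℝ → ℝ := fun p z => f p z.1
  let S : (ℕ → D) → Ω × ℝ → ℝ := fun p z =>
    s * scaledResidual κ f n p z.1 - c * √(scaledVar κ n p)
  let T : (ℕ → D) → Ω × ℝ → ℝ := fun p z =>
    √(scaledVar κ n p) * z.2 - c * √(scaledVar κ n p)
  have hv := continuous_scaledVar hκ n
  have hSc : ∀ z, Continuous fun p => S p z := fun z =>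
    ((continuous_scaledResidual hκ hfc n z.1).const_mul s).sub (hv.sqrt.const_mul c)
  have hTc : ∀ z, Continuous fun p => T p z := fun z =>
    (hv.sqrt.mul_const _).sub (hv.sqrt.const_mul c)
  have hS : Measurable (uncurry S) := measurable_uncurry_of_continuous_of_measurable hSc fun p =>
    (((measurable_scaledResidual hf n p).comp measurable_fst).const_mul s).sub_const _
  have hT : Measurable (uncurry T) := measurable_uncurry_of_continuous_of_measurable hTc fun p =>
    (measurable_snd.const_mul _).sub_const _
  have hf' : Measurable (uncurry f') := measurable_uncurry_of_continuous_of_measurable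
    (fun z => hfc z.1) fun p => (hf p).comp measurable_fst
  have hdet : ∀ p, SameDesignLaw (P.prod (gaussianReal 0 1)) f' n S T fun _ => p := by
    intro p
    have h := map_designOutputs_scaledResidual hf hG hmean hcov n p hs
    have hψ : Measurable fun y : (Fin n → ℝ) × ℝ => (y.1, y.2 - c * √(scaledVar κ n p)) :=
      measurable_fst.prodMk (measurable_snd.sub_const _)
    have h2 := congrArg (Measure.map fun y : (Fin n → ℝ) × ℝ =>
      (y.1, y.2 - c * √(scaledVar κ n p))) h
    have hout : Measurable (designOutputs f n p) := measurable_pi_lambda _ fun j => hf _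
    have m1 : Measurable fun z : Ω × ℝ =>
        (designOutputs f n p z.1, s * scaledResidual κ f n p z.1) :=
      (hout.comp measurable_fst).prodMk
        (((measurable_scaledResidual hf n p).comp measurable_fst).const_mul s)
    have m2 : Measurable fun z : Ω × ℝ =>
        (designOutputs f n p z.1, √(scaledVar κ n p) * z.2) :=
      (hout.comp measurable_fst).prodMk (measurable_snd.const_mul _)
    exact (Measure.map_map hψ m1).symm.trans (h2.trans (Measure.map_map hψ m2))
  let X' : Ω × ℝ → ℕ → D := fun z => X z.1
  obtain ⟨hX', hlaw⟩ : Measurable X' ∧ SameDesignLaw (P.prod (gaussianReal 0 1)) f' n S T X' :=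
    SameDesignLaw.of_adaptive hf' (fun z => hfc z.1) hS hSc hT hTc hdet hg
      (fun i hi z => hXg i hi z.1) (fun i hi z => hXq i hi z.1)
  have hA : MeasurableSet {y : (Fin n → ℝ) × ℝ | 0 < y.2} :=
    measurableSet_lt measurable_const measurable_snd
  have hlaw := congrArg (fun μ : Measure _ => μ {y : (Fin n → ℝ) × ℝ | 0 < y.2}) hlaw
  beta_reduce at hlaw
  rw [Measure.map_apply ((measurable_designOutputs hf' n hX').prodMk
      (measurable_statistic hS hX')) hA,
    Measure.map_apply ((measurable_designOutputs hf' n hX').prodMk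
      (measurable_statistic hT hX')) hA] at hlaw
  have hL : P {ω | c * √(scaledVar κ n (X ω)) < s * scaledResidual κ f n (X ω) ω} =
      (P.prod (gaussianReal 0 1)) ((fun z => (designOutputs f' n (X' z) z, S (X' z) z)) ⁻¹'
        {y : (Fin n → ℝ) × ℝ | 0 < y.2}) := by
    have : (fun z => (designOutputs f' n (X' z) z, S (X' z) z)) ⁻¹'
        {y : (Fin n → ℝ) × ℝ | 0 < y.2} =
        {ω | c * √(scaledVar κ n (X ω)) < s * scaledResidual κ f n (X ω) ω} ×ˢ Set.univ := by
      ext z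
      simp [S, X']
    rw [this, Measure.prod_prod]
    simp
  rw [hL, hlaw]
  -- `0 < T` forces `Z > c` whatever the random variance is; where the variance vanishes, `T = 0`
  -- and there is nothing to bound.
  refine le_trans (measure_mono (t := Set.univ ×ˢ Set.Ioi c) ?_) ?_
  · rintro z (hz : 0 < √(scaledVar κ n (X z.1)) * z.2 - c * √(scaledVar κ n (X z.1)))
    refine ⟨trivial, ?_⟩
    by_contra hle
    have hle : z.2 ≤ c := not_lt.1 hle
    nlinarith [mul_le_mul_of_nonneg_left hle (Real.sqrt_nonneg (scaledVar κ n (X z.1)))]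
  · rw [Measure.prod_prod]
    simpa using gaussianReal_Ioi_le hc

end ScaledResidual

end

noncomputable section

/-! ### Sensitivity of posterior mean and variance to the kernel -/

section Perturbation

open Matrix WithLp

variable {n : ℕ}

theorem norm_toLp_le {v : Fin n → ℝ} {a : ℝ} (ha : 0 ≤ a) (hv : ∀ i, |v i| ≤ a) :
    ‖toLp 2 v‖ ≤ √n * a := by
  rw [EuclideanSpace.norm_eq, ← Real.sqrt_sq ha, ← Real.sqrt_mul (Nat.cast_nonneg n)]
  refine Real.sqrt_le_sqrt ?_
  calc ∑ i, ‖toLp 2 v i‖ ^ 2 ≤ ∑ _i : Fin n, a ^ 2 := Finset.sum_le_sum fun i _ => by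
        simpa using sq_le_sq' (by linarith [abs_nonneg (v i), hv i]) (hv i)
    _ = n * a ^ 2 := by simp

theorem abs_dotProduct_mulVec_le {A : Matrix (Fin n) (Fin n) ℝ} {v w : Fin n → ℝ} {a b c : ℝ}
    (ha : 0 ≤ a) (hb : 0 ≤ b) (hA : ‖toEuclideanCLM (n := Fin n) (𝕜 := ℝ) A‖ ≤ c)
    (hv : ∀ i, |v i| ≤ a) (hw : ∀ i, |w i| ≤ b) : |v ⬝ᵥ (A *ᵥ w)| ≤ n * (a * c * b) := by
  have h := abs_real_inner_le_norm (toLp 2 v) (toEuclideanCLM (n := Fin n) (𝕜 := ℝ) A (toLp 2 w))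
  rw [inner_toEuclideanCLM] at h
  have hc : 0 ≤ c := (norm_nonneg _).trans hA
  calc |v ⬝ᵥ (A *ᵥ w)| ≤ ‖toLp 2 v‖ * ‖toEuclideanCLM (n := Fin n) (𝕜 := ℝ) A (toLp 2 w)‖ := h
    _ ≤ (√n * a) * (c * (√n * b)) := by
        refine mul_le_mul (norm_toLp_le ha hv) ?_ (norm_nonneg _) (by positivity)
        exact (ContinuousLinearMap.le_opNorm _ _).trans
          (mul_le_mul hA (norm_toLp_le hb hw) (norm_nonneg _) hc)
    _ = (√n * √n) * (a * c * b) := by ring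
    _ = n * (a * c * b) := by rw [Real.mul_self_sqrt (Nat.cast_nonneg n)]

theorem norm_toEuclideanCLM_le {A : Matrix (Fin n) (Fin n) ℝ} {ε : ℝ} (hε : 0 ≤ ε)
    (hA : ∀ i j, |A i j| ≤ ε) : ‖toEuclideanCLM (n := Fin n) (𝕜 := ℝ) A‖ ≤ n * ε := by
  refine ContinuousLinearMap.opNorm_le_bound _ (by positivity) fun v => ?_
  have hrow : ∀ i, |(A *ᵥ ofLp v) i| ≤ √n * ε * ‖v‖ := by
    intro i
    have h := abs_real_inner_le_norm (toLp 2 (A i)) v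
    rw [EuclideanSpace.inner_eq_star_dotProduct] at h
    have e : (A *ᵥ ofLp v) i = ofLp v ⬝ᵥ star (ofLp (toLp 2 (A i))) := by
      simp [mulVec, dotProduct_comm]
    rw [e]
    exact h.trans (mul_le_mul_of_nonneg_right (norm_toLp_le hε (hA i)) (norm_nonneg _))
  have := norm_toLp_le (by positivity) hrow
  calc ‖toEuclideanCLM (n := Fin n) (𝕜 := ℝ) A v‖ ≤ √n * (√n * ε * ‖v‖) := this
    _ = (√n * √n) * ε * ‖v‖ := by ring
    _ = n * ε * ‖v‖ := by rw [Real.mul_self_sqrt (Nat.cast_nonneg n)]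

/-- Perturbation bound for the inverse of a matrix. -/
theorem norm_toEuclideanCLM_inv_sub_inv_le {A B : Matrix (Fin n) (Fin n) ℝ} {ε c : ℝ}
    (hε : 0 ≤ ε) (hA : IsUnit A.det) (hB : IsUnit B.det)
    (hAc : ‖toEuclideanCLM (n := Fin n) (𝕜 := ℝ) A⁻¹‖ ≤ c)
    (hBc : ‖toEuclideanCLM (n := Fin n) (𝕜 := ℝ) B⁻¹‖ ≤ c) (hAB : ∀ i j, |A i j - B i j| ≤ ε) :
    ‖toEuclideanCLM (n := Fin n) (𝕜 := ℝ) (A⁻¹ - B⁻¹)‖ ≤ n * ε * c ^ 2 := by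
  have hc : 0 ≤ c := (norm_nonneg _).trans hAc
  have e : A⁻¹ - B⁻¹ = A⁻¹ * (B - A) * B⁻¹ := by
    rw [mul_sub, sub_mul, nonsing_inv_mul A hA, one_mul, mul_assoc, mul_nonsing_inv B hB, mul_one]
  have hd : ‖toEuclideanCLM (n := Fin n) (𝕜 := ℝ) (B - A)‖ ≤ n * ε :=
    norm_toEuclideanCLM_le hε fun i j => by rw [Matrix.sub_apply, abs_sub_comm]; exact hAB i j
  rw [e, map_mul, map_mul]
  calc _ ≤ ‖toEuclideanCLM (n := Fin n) (𝕜 := ℝ) A⁻¹‖ *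
        ‖toEuclideanCLM (n := Fin n) (𝕜 := ℝ) (B - A)‖ *
        ‖toEuclideanCLM (n := Fin n) (𝕜 := ℝ) B⁻¹‖ :=
        (norm_mul_le _ _).trans (mul_le_mul_of_nonneg_right (norm_mul_le _ _) (norm_nonneg _))
    _ ≤ c * (n * ε) * c := by gcongr
    _ = n * ε * c ^ 2 := by ring

variable {E : Type*} {K K' : E → E → ℝ} {X : Fin n → E} {x : E} {s ε κ₀ : ℝ}

/-- Perturbation bound for the posterior mean. -/
theorem abs_postMean_sub_le {y : Fin n → ℝ} {B : ℝ} (hε : 0 ≤ ε) (hκ₀ : 0 ≤ κ₀) (hB : 0 ≤ B)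
    (hK : WellConditioned K X s) (hK' : WellConditioned K' X s)
    (hXX : ∀ i j, |K (X i) (X j) - K' (X i) (X j)| ≤ ε) (hxX : ∀ i, |K x (X i) - K' x (X i)| ≤ ε)
    (hKx : ∀ i, |K x (X i)| ≤ κ₀) (hy : ∀ i, |y i| ≤ B) :
    |postMean K X y x - postMean K' X y x| ≤
      n * (ε * s⁻¹ * B) + n * (κ₀ * (n * ε * s⁻¹ ^ 2) * B) := by
  have e : postMean K X y x - postMean K' X y x =
      (kernelVec K X x - kernelVec K' X x) ⬝ᵥ ((gramMatrix K' X)⁻¹ *ᵥ y) +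
        kernelVec K X x ⬝ᵥ (((gramMatrix K X)⁻¹ - (gramMatrix K' X)⁻¹) *ᵥ y) := by
    simp only [postMean, sub_dotProduct, sub_mulVec, dotProduct_sub]
    ring
  rw [e]
  refine (abs_add_le _ _).trans (add_le_add ?_ ?_)
  · exact abs_dotProduct_mulVec_le hε hB hK'.2 hxX hy
  · exact abs_dotProduct_mulVec_le hκ₀ hB
      (norm_toEuclideanCLM_inv_sub_inv_le hε hK.1 hK'.1 hK.2 hK'.2 hXX) hKx hy

/-- Perturbation bound for the posterior variance. -/
theorem abs_postVar_sub_le (hε : 0 ≤ ε) (hκ₀ : 0 ≤ κ₀)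
    (hK : WellConditioned K X s) (hK' : WellConditioned K' X s)
    (hXX : ∀ i j, |K (X i) (X j) - K' (X i) (X j)| ≤ ε) (hxX : ∀ i, |K x (X i) - K' x (X i)| ≤ ε)
    (hxx : K x x = K' x x) (hKx : ∀ i, |K x (X i)| ≤ κ₀) (hKx' : ∀ i, |K' x (X i)| ≤ κ₀) :
    |postVar K X x - postVar K' X x| ≤
      n * (κ₀ * (n * ε * s⁻¹ ^ 2) * κ₀) + n * (ε * s⁻¹ * κ₀) + n * (κ₀ * s⁻¹ * ε) := by
  have e : postVar K X x - postVar K' X x =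
      -(kernelVec K X x ⬝ᵥ
        (((gramMatrix K X)⁻¹ - (gramMatrix K' X)⁻¹) *ᵥ kernelVec K X x) +
      (kernelVec K X x - kernelVec K' X x) ⬝ᵥ ((gramMatrix K' X)⁻¹ *ᵥ kernelVec K X x) +
        kernelVec K' X x ⬝ᵥ
          ((gramMatrix K' X)⁻¹ *ᵥ (kernelVec K X x - kernelVec K' X x))) := by
    simp only [postVar, sub_dotProduct, sub_mulVec, dotProduct_sub, mulVec_sub, hxx]
    ring
  rw [e, abs_neg]
  refine (abs_add_le _ _).trans (add_le_add ((abs_add_le _ _).trans (add_le_add ?_ ?_)) ?_)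
  · exact abs_dotProduct_mulVec_le hκ₀ hκ₀
      (norm_toEuclideanCLM_inv_sub_inv_le hε hK.1 hK'.1 hK.2 hK'.2 hXX) hKx hKx
  · exact abs_dotProduct_mulVec_le hε hκ₀ hK'.2 hxX hKx
  · exact abs_dotProduct_mulVec_le hκ₀ hε hK'.2 hKx' hxX

/-- Subadditivity of the square root. Negative arguments are allowed because the approximated
variance may be negative before truncation. -/
theorem abs_sqrt_sub_sqrt_le (a b : ℝ) : |√a - √b| ≤ √|a - b| := by
  have key : ∀ a b : ℝ, √a ≤ √b + √|a - b| := by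
    intro a b
    refine (Real.sqrt_le_sqrt (y := max b 0 + |a - b|) ?_).trans ?_
    · linarith [le_abs_self (a - b), le_max_left b 0]
    · have h : √b = √(max b 0) := by
        rcases le_total 0 b with hb | hb
        · rw [max_eq_left hb]
        · rw [max_eq_right hb, Real.sqrt_eq_zero_of_nonpos hb, Real.sqrt_zero]
      rw [h, Real.sqrt_le_left (by positivity), add_sq, Real.sq_sqrt (le_max_right _ _),
        Real.sq_sqrt (abs_nonneg _)]
      have : 0 ≤ √(max b 0) * √|a - b| := by positivity
      linarith
  rw [abs_sub_le_iff]
  constructor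
  · linarith [key a b]
  · have := key b a
    rw [abs_sub_comm] at this
    linarith

/-- Perturbation bound for the posterior mean in terms of the size of the data set. -/
theorem abs_postMean_sub_le_sq {y : Fin n → ℝ} {B V : ℝ} (hs : 0 < s) (hε : 0 ≤ ε)
    (hκ₀ : 0 ≤ κ₀) (hV : κ₀ ≤ V) (hB : 0 ≤ B) (hsκ : Fin n → s ≤ κ₀)
    (hK : WellConditioned K X s) (hK' : WellConditioned K' X s)
    (hXX : ∀ i j, |K (X i) (X j) - K' (X i) (X j)| ≤ ε) (hxX : ∀ i, |K x (X i) - K' x (X i)| ≤ ε)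
    (hKx : ∀ i, |K x (X i)| ≤ κ₀) (hy : ∀ i, |y i| ≤ B) :
    |postMean K X y x - postMean K' X y x| ≤ B * V / s ^ 2 * (n + 1) ^ 2 * ε := by
  refine (abs_postMean_sub_le hε hκ₀ hB hK hK' hXX hxX hKx hy).trans ?_
  -- With at least one data point `s ≤ κ₀ ≤ V`, so the term linear in `n` is measured in the same
  -- unit as the quadratic one, and `n + n² ≤ (n + 1)²`.
  have hn : (n : ℝ) * s ≤ n * V := by
    rcases Nat.eq_zero_or_pos n with rfl | h
    · simp
    · exact mul_le_mul_of_nonneg_left ((hsκ ⟨0, h⟩).trans hV) (Nat.cast_nonneg n)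
  have e : n * (ε * s⁻¹ * B) + n * (κ₀ * (n * ε * s⁻¹ ^ 2) * B) =
      (n * s + n ^ 2 * κ₀) * (ε * B / s ^ 2) := by
    field_simp
  have e' : B * V / s ^ 2 * (n + 1) ^ 2 * ε = ((n + 1) ^ 2 * V) * (ε * B / s ^ 2) := by ring
  rw [e, e']
  refine mul_le_mul_of_nonneg_right ?_ (by positivity)
  have h2 : (n : ℝ) ^ 2 * κ₀ ≤ n ^ 2 * V := mul_le_mul_of_nonneg_left hV (by positivity)
  have h3 : 0 ≤ (n + 1) * V := mul_nonneg (by positivity) (hκ₀.trans hV)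
  linarith

/-- Perturbation bound for the posterior standard deviation in terms of the size of the data set. -/
theorem abs_postStd_sub_le {V : ℝ} (hs : 0 < s) (hε : 0 ≤ ε)
    (hκ₀ : 0 ≤ κ₀) (hV : κ₀ ≤ V) (hsκ : Fin n → s ≤ κ₀)
    (hK : WellConditioned K X s) (hK' : WellConditioned K' X s)
    (hXX : ∀ i j, |K (X i) (X j) - K' (X i) (X j)| ≤ ε) (hxX : ∀ i, |K x (X i) - K' x (X i)| ≤ ε)
    (hxx : K x x = K' x x) (hKx : ∀ i, |K x (X i)| ≤ κ₀) (hKx' : ∀ i, |K' x (X i)| ≤ κ₀) :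
    |postStd K X x - postStd K' X x| ≤ V / s * (n + 1) * √ε := by
  have hV0 : 0 ≤ V := hκ₀.trans hV
  refine (abs_sqrt_sub_sqrt_le _ _).trans ?_
  rw [Real.sqrt_le_left (by positivity), mul_pow, Real.sq_sqrt hε]
  refine (abs_postVar_sub_le hε hκ₀ hK hK' hXX hxX hxx hKx hKx').trans ?_
  have hn : (n : ℝ) * s ≤ n * V := by
    rcases Nat.eq_zero_or_pos n with rfl | h
    · simp
    · exact mul_le_mul_of_nonneg_left ((hsκ ⟨0, h⟩).trans hV) (Nat.cast_nonneg n)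
  have e : n * (κ₀ * (n * ε * s⁻¹ ^ 2) * κ₀) + n * (ε * s⁻¹ * κ₀) + n * (κ₀ * s⁻¹ * ε) =
      (n ^ 2 * κ₀ ^ 2 + 2 * (n * s) * κ₀) * (ε / s ^ 2) := by
    field_simp
    ring
  have e' : (V / s * (n + 1)) ^ 2 * ε = ((n + 1) ^ 2 * V ^ 2) * (ε / s ^ 2) := by ring
  rw [e, e']
  refine mul_le_mul_of_nonneg_right ?_ (by positivity)
  have h2 : (n : ℝ) ^ 2 * κ₀ ^ 2 ≤ n ^ 2 * V ^ 2 := by gcongr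
  have h3 : 2 * (n * s) * κ₀ ≤ 2 * (n * V) * V := by gcongr
  nlinarith [sq_nonneg V]

/-- The conditioning parameter of a positive semidefinite Gram matrix is at most its diagonal
entries. -/
theorem WellConditioned.le_diag (hK : WellConditioned K X s) (hs : 0 < s)
    (hpos : (gramMatrix K X).PosSemidef) (i : Fin n) : s ≤ K (X i) (X i) := by
  set G := gramMatrix K X
  set e : Fin n → ℝ := Pi.single i 1
  set u := G⁻¹ *ᵥ e
  have hGu : G *ᵥ u = e := by rw [mulVec_mulVec, mul_nonsing_inv G hK.1, one_mulVec]
  have hGt : Gᵀ = G := by simpa using hpos.isHermitian.eq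
  -- Since `G u = e`, the quadratic form at `e - s u` is `K (X i) (X i) - 2 s + s² (e ⬝ᵥ u)`, and `e
  -- ⬝ᵥ u ≤ s⁻¹` bounds its last term by `s`.
  have h0 := (posSemidef_iff_dotProduct_mulVec.1 hpos).2 (e - s • u)
  have h1 : u ⬝ᵥ (G *ᵥ e) = 1 := by
    rw [dotProduct_mulVec, ← mulVec_transpose, hGt, hGu]
    simp [e]
  have h2 : e ⬝ᵥ (G *ᵥ e) = K (X i) (X i) := by simp [e, G, gramMatrix]
  have h3 : e ⬝ᵥ e = 1 := by simp [e]
  have h4 : e ⬝ᵥ u ≤ s⁻¹ := by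
    have h := abs_real_inner_le_norm (toLp 2 e)
      (toEuclideanCLM (n := Fin n) (𝕜 := ℝ) G⁻¹ (toLp 2 e))
    rw [inner_toEuclideanCLM] at h
    have hn : ‖toLp 2 e‖ = 1 := by
      rw [EuclideanSpace.norm_eq]
      simp [e, Pi.single_apply]
    have h' := (toEuclideanCLM (n := Fin n) (𝕜 := ℝ) G⁻¹).le_opNorm (toLp 2 e)
    rw [hn, mul_one] at h'
    rw [hn, one_mul] at h
    exact (le_abs_self _).trans (h.trans (h'.trans hK.2))
  rw [star_trivial, mulVec_sub, mulVec_smul, hGu, sub_dotProduct, dotProduct_sub, dotProduct_sub,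
    smul_dotProduct, smul_dotProduct, dotProduct_smul, dotProduct_smul, h1, h2, h3,
    dotProduct_comm u e] at h0
  simp only [smul_eq_mul] at h0
  have h5 : s * (s * (e ⬝ᵥ u)) ≤ s := by
    calc s * (s * (e ⬝ᵥ u)) ≤ s * (s * s⁻¹) := by gcongr
      _ = s := by rw [mul_inv_cancel₀ hs.ne', mul_one]
  linarith

end Perturbation

/-! ### Values and bounds of the interpolated profile -/

section Interpolation

/-- The first breakpoint is `0`, so the prior variance is reproduced exactly and adds no error to
the posterior variance. -/
theorem pwlInterp_zero {M : ℕ} (k : ℝ → ℝ) {R : Fin (M + 1) → ℝ} (hR : StrictMono R)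
    (hR0 : R 0 = 0) : pwlInterp k R 0 = k 0 := by
  rw [pwlInterp, hR0, Finset.sum_eq_zero, add_zero]
  intro j _
  have h : 0 ≤ R j.castSucc := hR0 ▸ hR.monotone (Fin.zero_le _)
  rw [max_eq_left ((min_le_left _ _).trans h), sub_self, mul_zero]

theorem exists_piece {M : ℕ} {R : Fin (M + 1) → ℝ} {ρ : ℝ} (h₁ : R 0 < ρ)
    (h₂ : ρ ≤ R (Fin.last M)) : ∃ i : Fin M, R i.castSucc ≤ ρ ∧ ρ ≤ R i.succ := by
  by_contra! h
  have : ∀ i : Fin (M + 1), R i < ρ := by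
    intro i
    induction i using Fin.induction with
    | zero => exact h₁
    | succ i ih => exact h i ih.le
  exact absurd (this (Fin.last M)) (not_lt.2 h₂)

/-- The interpolant inherits bounds of the interpolated function. -/
theorem abs_pwlInterp_le {M : ℕ} {k : ℝ → ℝ} {R : Fin (M + 1) → ℝ} (hR : StrictMono R)
    (hR0 : R 0 = 0) {c : ℝ} (hk : ∀ ρ, 0 ≤ ρ → |k ρ| ≤ c) {ρ : ℝ} (h₁ : 0 ≤ ρ)
    (h₂ : ρ ≤ R (Fin.last M)) : |pwlInterp k R ρ| ≤ c := by
  rcases h₁.eq_or_lt with rfl | hpos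
  · rw [pwlInterp_zero k hR hR0]
    exact hk 0 le_rfl
  · obtain ⟨i, hi₁, hi₂⟩ := exists_piece (hR0 ▸ hpos) h₂
    have hlt : R i.castSucc < R i.succ := hR (by simp [Fin.lt_def])
    have hnn : ∀ j, 0 ≤ R j := fun j => hR0 ▸ hR.monotone (Fin.zero_le j)
    rw [pwlInterp_eq_chord k R hR i hi₁ hi₂]
    set θ := (ρ - R i.castSucc) / (R i.succ - R i.castSucc)
    have hθ0 : 0 ≤ θ := div_nonneg (by linarith) (by linarith)
    have hθ1 : θ ≤ 1 := (div_le_one (by linarith)).2 (by linarith)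
    have e : k (R i.castSucc) +
        (k (R i.succ) - k (R i.castSucc)) / (R i.succ - R i.castSucc) * (ρ - R i.castSucc) =
        (1 - θ) * k (R i.castSucc) + θ * k (R i.succ) := by
      simp only [θ]
      ring
    have ha := abs_le.1 (hk _ (hnn i.castSucc))
    have hb := abs_le.1 (hk _ (hnn i.succ))
    rw [e, abs_le]
    constructor <;> nlinarith

end Interpolation

/-! ### Optimality for the approximated lower confidence bound -/

section LCB

open Matrix

variable {d n : ℕ} {D : Set (EuclideanSpace ℝ (Fin d))} {kt : ℝ → ℝ} {l β : ℝ}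
  {X : Fin n → EuclideanSpace ℝ (Fin d)} {y : Fin n → ℝ} {x : EuclideanSpace ℝ (Fin d)}

/-- The point of an optimal solution of the optimization model minimizes the approximated lower
confidence bound. -/
theorem IsLCBSolution.le (hl : 0 < l) (h : IsLCBSolution D kt l β X y x)
    {z : EuclideanSpace ℝ (Fin d)} (hz : z ∈ D) :
    postMean (radialKernel kt l) X y x - √β * postStd (radialKernel kt l) X x ≤
      postMean (radialKernel kt l) X y z - √β * postStd (radialKernel kt l) X z := by
  obtain ⟨v, rfl, hv, hopt⟩ := h
  have hvar : ∀ w, postVar (radialKernel kt l) X w = kt 0 - kernelVec (radialKernel kt l) X w ⬝ᵥ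
      ((gramMatrix (radialKernel kt l) X)⁻¹ *ᵥ kernelVec (radialKernel kt l) X w) := by
    intro w
    simp [postVar, radialKernel]
  have hκ : v.κ = kernelVec (radialKernel kt l) X v.x := by
    funext i
    rw [hv.kernel_eq, kernelVec, radialKernel]
    congr 1
    rw [← sq_eq_sq₀ (hv.dist_nonneg i) (by positivity), hv.dist_eq, div_pow]
  have h1 : v.σ ≤ postStd (radialKernel kt l) X v.x := by
    have := hv.var_le
    rw [hκ, ← hvar] at this
    refine Real.le_sqrt_of_sq_le ?_ |>.trans_eq
      (?_ : √(max 0 (postVar (radialKernel kt l) X v.x)) = _)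
    · exact this
    · rw [postStd]
      rcases le_total 0 (postVar (radialKernel kt l) X v.x) with h | h
      · rw [max_eq_right h]
      · rw [max_eq_left h, Real.sqrt_eq_zero_of_nonpos h, Real.sqrt_zero]
  -- The competitor at `z` takes the largest feasible `σ`, namely the truncated posterior standard
  -- deviation.
  have h2 := hopt ⟨z, postMean (radialKernel kt l) X y z, postStd (radialKernel kt l) X z,
    fun i => ‖z - X i‖ / l, kernelVec (radialKernel kt l) X z⟩
    { mem := hz
      mean_eq := rfl
      var_le := by
        rw [← hvar]
        change √(postVar (radialKernel kt l) X z) ^ 2 ≤ _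
        rcases le_total 0 (postVar (radialKernel kt l) X z) with h | h
        · rw [Real.sq_sqrt h]
          exact le_max_right _ _
        · rw [Real.sqrt_eq_zero_of_nonpos h]
          simp
      dist_nonneg := fun i => by positivity
      dist_eq := fun i => div_pow _ _ _
      kernel_eq := fun i => rfl }
  have h3 : v.μ = postMean (radialKernel kt l) X y v.x := by rw [hv.mean_eq, hκ]; rfl
  simp only [lcbObjective, h3] at h2
  nlinarith [mul_le_mul_of_nonneg_left h1 (Real.sqrt_nonneg β)]

/-- Posterior confidence bounds for the exact kernel at a minimizer of the approximated lower
confidence bound and at a comparison point bound the difference of the function values. -/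
theorem IsLCBSolution.sub_le {k : ℝ → ℝ} {ε B σmax σε fx fz : ℝ} {M : ℕ} {R : Fin (M + 1) → ℝ}
    (hR : StrictMono R) (hR0 : R 0 = 0)
    (hRlast : ∀ x ∈ D, ∀ y ∈ D, ‖x - y‖ / l ≤ R (Fin.last M))
    (hε : ∀ ρ ∈ Set.Icc 0 (R (Fin.last M)), |k ρ - pwlInterp k R ρ| ≤ ε)
    (hk : ∀ ρ, 0 ≤ ρ → |k ρ| ≤ k 0) (hσmax : k 0 ≤ σmax ^ 2) (hl : 0 < l)
    (h : IsLCBSolution D (pwlInterp k R) l β X y x) (hX : ∀ i, X i ∈ D) (hx : x ∈ D)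
    (hpos : (gramMatrix (radialKernel k l) X).PosSemidef) (hσε : 0 < σε)
    (hK : WellConditioned (radialKernel k l) X (σε ^ 2))
    (hK' : WellConditioned (radialKernel (pwlInterp k R) l) X (σε ^ 2))
    (hB : 0 ≤ B) (hy : ∀ i, |y i| ≤ B)
    {z : EuclideanSpace ℝ (Fin d)} (hz : z ∈ D)
    (hfx : fx - postMean (radialKernel k l) X y x ≤ √β * postStd (radialKernel k l) X x)
    (hfz : postMean (radialKernel k l) X y z - fz ≤ √β * postStd (radialKernel k l) X z) :
    fx - fz ≤ 2 * √β * postStd (radialKernel k l) X x +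
      2 * (B * σmax ^ 2 / σε ^ 4) * (n + 1) ^ 2 * ε +
      4 * (σmax ^ 2 / σε ^ 2) * √β * (n + 1) * √ε := by
  have hε0 : 0 ≤ ε := (abs_nonneg _).trans
    (hε 0 ⟨le_rfl, hR0 ▸ hR.monotone (Fin.zero_le _)⟩)
  have hk0 : 0 ≤ k 0 := (abs_nonneg _).trans (hk 0 le_rfl)
  have hdist : ∀ {u v}, u ∈ D → v ∈ D → ‖u - v‖ / l ∈ Set.Icc 0 (R (Fin.last M)) :=
    fun hu hv => ⟨by positivity, hRlast _ hu _ hv⟩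
  have hsκ : Fin n → σε ^ 2 ≤ k 0 := fun i => by
    simpa [radialKernel] using hK.le_diag (by positivity) hpos i
  have hmean : ∀ w ∈ D, |postMean (radialKernel k l) X y w -
      postMean (radialKernel (pwlInterp k R) l) X y w| ≤
        B * σmax ^ 2 / (σε ^ 2) ^ 2 * (n + 1) ^ 2 * ε := fun w hw =>
    abs_postMean_sub_le_sq (by positivity) hε0 hk0 hσmax hB hsκ hK hK'
      (fun i j => hε _ (hdist (hX i) (hX j))) (fun i => hε _ (hdist hw (hX i)))
      (fun i => hk _ (hdist hw (hX i)).1) hy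
  have hstd : ∀ w ∈ D, |postStd (radialKernel k l) X w -
      postStd (radialKernel (pwlInterp k R) l) X w| ≤
        σmax ^ 2 / σε ^ 2 * (n + 1) * √ε := fun w hw =>
    abs_postStd_sub_le (by positivity) hε0 hk0 hσmax hsκ hK hK'
      (fun i j => hε _ (hdist (hX i) (hX j))) (fun i => hε _ (hdist hw (hX i)))
      (by simp [radialKernel, pwlInterp_zero k hR hR0])
      (fun i => hk _ (hdist hw (hX i)).1)
      (fun i => abs_pwlInterp_le hR hR0 hk (hdist hw (hX i)).1 (hdist hw (hX i)).2)
  have hopt := h.le hl hz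
  have hσε4 : (σε ^ 2) ^ 2 = σε ^ 4 := by ring
  rw [hσε4] at hmean
  -- Mean and standard deviation errors are each needed twice, once at `x` and once at `z`; the
  -- coefficient `4` leaves slack, covered by `s4`.
  have m1 := abs_le.1 (hmean x hx)
  have m2 := abs_le.1 (hmean z hz)
  have s1 := mul_le_mul_of_nonneg_left (abs_le.1 (hstd x hx)).2 (Real.sqrt_nonneg β)
  have s2 := mul_le_mul_of_nonneg_left (abs_le.1 (hstd z hz)).2 (Real.sqrt_nonneg β)
  have s3 := mul_le_mul_of_nonneg_left (abs_le.1 (hstd x hx)).1 (Real.sqrt_nonneg β)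
  have s4 : 0 ≤ √β * (σmax ^ 2 / σε ^ 2 * (n + 1) * √ε) := by positivity
  linarith [m1.1, m1.2, m2.1, m2.2]

end LCB

end

noncomputable section

/-! ### Confidence bounds at adaptively chosen points -/

section Confidence

open Filter Topology Function Matrix

variable {Ω D : Type*}

/-- The design whose `j`-th point is chosen by the policy `g j` from the previous outputs. -/
def adaptiveDesign (f : D → Ω → ℝ) (g : (j : ℕ) → (Fin j → ℝ) → D) (ω : Ω) (j : ℕ) : D :=
  g j fun i : Fin j => f (adaptiveDesign f g ω i) ω
termination_by j
decreasing_by exact i.2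

theorem adaptiveDesign_eq (f : D → Ω → ℝ) (g : (j : ℕ) → (Fin j → ℝ) → D) (ω : Ω) (j : ℕ) :
    adaptiveDesign f g ω j = g j (designOutputs f j (adaptiveDesign f g ω) ω) := by
  rw [adaptiveDesign]
  rfl

/-- Allows the policy to be changed from time `n` on without disturbing the first `n` points. -/
theorem adaptiveDesign_congr (f : D → Ω → ℝ) {g g' : (j : ℕ) → (Fin j → ℝ) → D} {n : ℕ}
    (h : ∀ j < n, g j = g' j) (ω : Ω) {j : ℕ} (hj : j < n) :
    adaptiveDesign f g ω j = adaptiveDesign f g' ω j := by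
  induction j using Nat.strong_induction_on with
  | _ j ih =>
    rw [adaptiveDesign, adaptiveDesign, h j hj]
    congr 1
    funext i
    rw [ih i i.2 (i.2.trans hj)]

/-- The scaled tail event contains the failure of the posterior confidence bound. -/
theorem mul_sub_postMean_le {κ : D → D → ℝ} {f : D → Ω → ℝ} {n : ℕ} {p : ℕ → D} {ω : Ω} {s c : ℝ}
    (hdet : 0 < (gramMatrix κ fun j : Fin n => p j).det)
    (h : s * scaledResidual κ f n p ω ≤ c * √(scaledVar κ n p)) :
    s * (f (p n) ω - postMean κ (fun j : Fin n => p j) (designOutputs f n p ω) (p n)) ≤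
      c * postStd κ (fun j : Fin n => p j) (p n) := by
  set G := gramMatrix κ fun j : Fin n => p j with hG
  have hinv : G⁻¹ = G.det⁻¹ • G.adjugate := by rw [inv_def, Ring.inverse_eq_inv']
  have h1 : scaledResidual κ f n p ω = G.det *
      (f (p n) ω - postMean κ (fun j : Fin n => p j) (designOutputs f n p ω) (p n)) := by
    rw [scaledResidual, postMean, ← hG, hinv, smul_mulVec, dotProduct_smul, smul_eq_mul, mul_sub,
      mul_inv_cancel_left₀ hdet.ne']
  have h2 : scaledVar κ n p = G.det ^ 2 * postVar κ (fun j : Fin n => p j) (p n) := by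
    rw [scaledVar, postVar, ← hG, hinv, smul_mulVec, dotProduct_smul, smul_eq_mul]
    field_simp
  rw [h1, h2, Real.sqrt_mul (sq_nonneg _), Real.sqrt_sq hdet.le] at h
  rw [postStd]
  refine le_of_mul_le_mul_left ?_ hdet
  linarith

/-- The one-sided posterior confidence bound, with parameter `c`, for the value `w` at the point
`z`, given the values `y` at the points `X`: an upper bound of `w` for `s = 1` and a lower bound for
`s = -1`. -/
def ConfidenceBound (κ : D → D → ℝ) {n : ℕ} (X : Fin n → D) (y : Fin n → ℝ) (z : D)
    (w s c : ℝ) : Prop :=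
  IsUnit (gramMatrix κ X).det → s * (w - postMean κ X y z) ≤ c * postStd κ X z

variable [MeasurableSpace Ω] {P : Measure Ω} {f : D → Ω → ℝ} {κ : D → D → ℝ}

/-- The quadratic form at `c` is the variance of `∑ i, c i * f (X i)`. -/
theorem posSemidef_gramMatrix [IsProbabilityMeasure P] (hG : IsGaussianProcess f P)
    (hcov : ∀ p q, cov[f p, f q; P] = κ p q) {n : ℕ} (X : Fin n → D) :
    (gramMatrix κ X).PosSemidef := by
  have hL : ∀ x, MemLp (f x) 2 P := fun x => (hG.hasGaussianLaw_eval x).memLp_two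
  refine posSemidef_iff_dotProduct_mulVec.2 ⟨?_, fun c => ?_⟩
  · ext i j
    simp only [conjTranspose_apply, gramMatrix, of_apply, star_trivial, ← hcov]
    exact covariance_comm _ _
  · have h := covariance_fun_sum_fun_sum (μ := P) (X := fun i ω => c i * f (X i) ω)
      (Y := fun i ω => c i * f (X i) ω) (fun i => (hL _).const_mul _) (fun i => (hL _).const_mul _)
    rw [covariance_self (memLp_finsetSum _ fun i _ => (hL _).const_mul _).aemeasurable] at h
    have hv := variance_nonneg (fun ω => ∑ i, c i * f (X i) ω) P
    rw [h] at hv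
    refine hv.trans_eq ?_
    simp only [covariance_const_mul_left, covariance_const_mul_right, hcov, star_trivial,
      dotProduct, mulVec, gramMatrix, of_apply, Finset.mul_sum]
    exact Finset.sum_congr rfl fun i _ => Finset.sum_congr rfl fun j _ => by ring

variable [MetricSpace D] [SecondCountableTopology D] [MeasurableSpace D] [BorelSpace D]

/-- The posterior confidence bound at an adaptively chosen point, given the values of the process at
adaptively chosen points, fails with probability at most `exp (-c ^ 2 / 2)`. -/
theorem measure_not_confidence_le [IsProbabilityMeasure P]
    (hf : ∀ p, Measurable (f p)) (hfc : ∀ ω, Continuous fun p => f p ω)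
    (hG : IsGaussianProcess f P) (hmean : ∀ p, ∫ ω, f p ω ∂P = 0)
    (hcov : ∀ p q, cov[f p, f q; P] = κ p q) {g : (i : ℕ) → (Fin i → ℝ) → D}
    (hg : ∀ i, Measurable (g i)) {n : ℕ} {ζ : (Fin n → ℝ) → D} (hζ : Measurable ζ)
    {s : ℝ} (hs : s ^ 2 = 1) {c : ℝ} (hc : 0 ≤ c) :
    P {ω | ¬ ConfidenceBound κ (fun j : Fin n => adaptiveDesign f g ω j)
      (designOutputs f n (adaptiveDesign f g ω) ω)
      (ζ (designOutputs f n (adaptiveDesign f g ω) ω))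
      (f (ζ (designOutputs f n (adaptiveDesign f g ω) ω)) ω) s c} ≤
      ENNReal.ofReal (Real.exp (-c ^ 2 / 2)) := by
  let q : D := g 0 0
  -- The test point is made the `n`-th design point: follow `g` for `n` steps, then query `ζ`, then
  -- stay at an arbitrary constant `q`.
  let g' : (i : ℕ) → (Fin i → ℝ) → D := fun i y =>
    if i < n then g i y else if h : n = i then ζ fun j => y (Fin.cast h j) else q
  have hg' : ∀ i, Measurable (g' i) := by
    intro i
    rcases lt_trichotomy i n with h | rfl | h
    · simpa [g', h] using hg i
    · simpa [g'] using hζ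
    · simp [g', h.not_gt, h.ne]
  have hgn : ∀ y, g' n y = ζ y := fun y => by simp [g']
  have hlt : ∀ ω, ∀ j < n, adaptiveDesign f g' ω j = adaptiveDesign f g ω j := fun ω j hj =>
    adaptiveDesign_congr f (fun i hi => by funext y; simp [g', hi]) ω hj
  have hout : ∀ ω, designOutputs f n (adaptiveDesign f g' ω) ω =
      designOutputs f n (adaptiveDesign f g ω) ω := fun ω => by
    funext j
    simp [designOutputs, hlt ω j j.2]
  have hX : ∀ ω, (fun j : Fin n => adaptiveDesign f g' ω j) =
      fun j : Fin n => adaptiveDesign f g ω j := fun ω => funext fun j => hlt ω j j.2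
  have hn : ∀ ω, adaptiveDesign f g' ω n =
      ζ (designOutputs f n (adaptiveDesign f g ω) ω) := fun ω => by
    rw [adaptiveDesign_eq, hgn, hout]
  refine le_trans (measure_mono fun ω hω => ?_) (measure_scaledResidual_gt_le hf hfc hG hmean hcov
    (n := n) (X := adaptiveDesign f g') hg' (fun i _ ω => adaptiveDesign_eq f g' ω i) (q := q)
    (fun i hi ω => by rw [adaptiveDesign]; simp [g', hi.not_gt, hi.ne]) hs hc)
  by_contra hle
  refine hω fun hdet => ?_
  have hdet' : 0 < (gramMatrix κ fun j : Fin n => adaptiveDesign f g' ω j).det := by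
    rw [hX]
    exact (posSemidef_gramMatrix hG hcov _).det_nonneg.lt_of_ne' hdet.ne_zero
  have := mul_sub_postMean_le hdet' (not_lt.1 hle)
  rwa [hX, hout, hn] at this

end Confidence

/-! ### A version with continuous paths -/

section Modification

open Filter Topology

theorem covariance_congr_ae {Ω : Type*} [MeasurableSpace Ω] {P : Measure Ω} {X X' Y Y' : Ω → ℝ}
    (hX : X =ᵐ[P] X') (hY : Y =ᵐ[P] Y') : cov[X, Y; P] = cov[X', Y'; P] := by
  rw [covariance, covariance, integral_congr_ae hX, integral_congr_ae hY]
  refine integral_congr_ae ?_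
  filter_upwards [hX, hY] with ω h1 h2
  rw [h1, h2]

/-- A process whose paths are almost surely continuous agrees almost surely with one that is
measurable and has continuous paths everywhere. -/
theorem exists_continuous_version {Ω T : Type*} [MeasurableSpace Ω] {P : Measure Ω}
    [MetricSpace T] [SecondCountableTopology T] {f : T → Ω → ℝ} (hf : ∀ p, AEMeasurable (f p) P)
    (hfc : ∀ᵐ ω ∂P, Continuous fun p => f p ω) :
    ∃ f' : T → Ω → ℝ, (∀ p, Measurable (f' p)) ∧ (∀ ω, Continuous fun p => f' p ω) ∧
      ∀ᵐ ω ∂P, ∀ p, f' p ω = f p ω := by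
  obtain ⟨Q, hQc, hQd⟩ := TopologicalSpace.exists_countable_dense T
  have hae : ∀ᵐ ω ∂P, (Continuous fun p => f p ω) ∧ ∀ q ∈ Q, f q ω = (hf q).mk (f q) ω :=
    hfc.and ((ae_ball_iff hQc).2 fun q _ => (hf q).ae_eq_mk)
  -- The new process is `0` on the measurable null set `N`. Off `N` it equals a measurable version
  -- on the countable dense set `Q`, and measurability at the other points follows by limits along
  -- `Q`.
  obtain ⟨N, hN, hNm, hN0⟩ := exists_measurable_superset_of_null (ae_iff.1 hae)
  have hgood : ∀ ω ∈ Nᶜ, (Continuous fun p => f p ω) ∧ ∀ q ∈ Q, f q ω = (hf q).mk (f q) ω :=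
    fun ω hω => by
      by_contra h
      exact hω (hN h)
  refine ⟨fun p => Nᶜ.indicator (f p), fun p => ?_, fun ω => ?_, ?_⟩
  · obtain ⟨u, huQ, hup⟩ := mem_closure_iff_seq_limit.1 (hQd p)
    refine measurable_of_tendsto_metrizable (f := fun m => Nᶜ.indicator (f (u m))) (fun m => ?_)
      (tendsto_pi_nhds.2 fun ω => ?_)
    · have : Nᶜ.indicator (f (u m)) = Nᶜ.indicator ((hf (u m)).mk (f (u m))) :=
        Set.indicator_congr fun ω hω => (hgood ω hω).2 _ (huQ m)
      rw [this]
      exact (hf _).measurable_mk.indicator hNm.compl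
    · by_cases hω : ω ∈ Nᶜ
      · simp only [Set.indicator_of_mem hω]
        exact ((hgood ω hω).1.tendsto p).comp hup
      · simp only [Set.indicator_of_notMem hω]
        exact tendsto_const_nhds
  · by_cases hω : ω ∈ Nᶜ
    · simpa only [Set.indicator_of_mem hω] using (hgood ω hω).1
    · simp only [Set.indicator_of_notMem hω]
      exact continuous_const
  · have : ∀ᵐ ω ∂P, ω ∉ N := measure_eq_zero_iff_ae_notMem.1 hN0
    filter_upwards [this] with ω hω p
    exact Set.indicator_of_mem hω _

end Modification

end

noncomputable section

/-! ### Lipschitz bound from the tail of the partial derivatives -/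

section Gradient

variable {Ω : Type*} [MeasurableSpace Ω] {P : Measure Ω} {d : ℕ}
  {D : Set (EuclideanSpace ℝ (Fin d))}

/-- With the sub-Gaussian tail of the partial derivatives, all of them are bounded by
`b √(log (4 d a / δ))` outside an event of probability at most `δ / 4`. -/
theorem measure_gradient_gt_le {g : Ω → EuclideanSpace ℝ (Fin d) → EuclideanSpace ℝ (Fin d)}
    {a b δ : ℝ} (ha : 0 < a) (hb : 0 < b) (hδ : 0 < δ)
    (htail : ∀ j : Fin d, ∀ L : ℝ, 0 < L →
      P {ω | ∃ x ∈ D, L < |g ω x j|} ≤ ENNReal.ofReal (a * Real.exp (-(L / b) ^ 2))) :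
    P {ω | ∃ j, ∃ x ∈ D, b * √(Real.log (4 * d * a / δ)) < |g ω x j|} ≤
      ENNReal.ofReal (δ / 4) := by
  rcases Nat.eq_zero_or_pos d with rfl | hd
  · have : {ω | ∃ j : Fin 0, ∃ x ∈ D, b * √(Real.log (4 * (0 : ℕ) * a / δ)) < |g ω x j|} = ∅ := by
      ext ω
      simp
    rw [this, measure_empty]
    exact bot_le
  have hd' : (0 : ℝ) < d := Nat.cast_pos.2 hd
  set L := b * √(Real.log (4 * d * a / δ))
  have hone : ∀ j, P {ω | ∃ x ∈ D, L < |g ω x j|} ≤ ENNReal.ofReal (δ / (4 * d)) := by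
    intro j
    rcases le_or_gt (4 * d * a / δ) 1 with h | h
    · have hlog : Real.log (4 * d * a / δ) ≤ 0 := Real.log_nonpos (by positivity) h
      have hL : L = 0 := by simp only [L, Real.sqrt_eq_zero_of_nonpos hlog, mul_zero]
      have hU : {ω | ∃ x ∈ D, L < |g ω x j|} =
          ⋃ m : ℕ, {ω | ∃ x ∈ D, 1 / ((m : ℝ) + 1) < |g ω x j|} := by
        ext ω
        simp only [Set.mem_ofPred_eq, Set.mem_iUnion, hL]
        constructor
        · rintro ⟨x, hx, h0⟩
          obtain ⟨m, hm⟩ := exists_nat_one_div_lt h0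
          exact ⟨m, x, hx, hm⟩
        · rintro ⟨m, x, hx, hm⟩
          exact ⟨x, hx, lt_trans (by positivity) hm⟩
      have hmono : Monotone fun m : ℕ => {ω | ∃ x ∈ D, 1 / ((m : ℝ) + 1) < |g ω x j|} := by
        rintro m m' hmm' ω ⟨x, hx, hm⟩
        exact ⟨x, hx, (one_div_le_one_div_of_le (by positivity) (by gcongr)).trans_lt hm⟩
      rw [hU, hmono.measure_iUnion]
      refine iSup_le fun m => (htail j _ (by positivity)).trans (ENNReal.ofReal_le_ofReal ?_)
      have h1 : Real.exp (-(1 / ((m : ℝ) + 1) / b) ^ 2) ≤ 1 :=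
        Real.exp_le_one_iff.2 (neg_nonpos.2 (sq_nonneg _))
      have h2 : a ≤ δ / (4 * d) := by
        rw [div_le_one hδ] at h
        rw [le_div_iff₀ (by positivity)]
        linarith
      calc _ ≤ a * 1 := mul_le_mul_of_nonneg_left h1 ha.le
        _ ≤ _ := by rwa [mul_one]
    · have hlog : 0 < Real.log (4 * d * a / δ) := Real.log_pos h
      refine (htail j L (by positivity)).trans_eq ?_
      congr 1
      have : L / b = √(Real.log (4 * d * a / δ)) := by
        simp only [L]
        field_simp
      rw [this, Real.sq_sqrt hlog.le, Real.exp_neg, Real.exp_log (by positivity)]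
      field_simp
  have hU : {ω | ∃ j, ∃ x ∈ D, L < |g ω x j|} = ⋃ j, {ω | ∃ x ∈ D, L < |g ω x j|} := by
    ext ω
    simp
  rw [hU]
  calc _ ≤ ∑ j, P {ω | ∃ x ∈ D, L < |g ω x j|} := measure_iUnion_fintype_le _ _
    _ ≤ ∑ _j : Fin d, ENNReal.ofReal (δ / (4 * d)) := Finset.sum_le_sum fun j _ => hone j
    _ = ENNReal.ofReal (δ / 4) := by
        rw [Finset.sum_const, Finset.card_univ, Fintype.card_fin, nsmul_eq_mul,
          ← ENNReal.ofReal_natCast, ← ENNReal.ofReal_mul (Nat.cast_nonneg d)]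
        congr 1
        field_simp

/-- A function on a convex set whose partial derivatives are bounded by `L` is Lipschitz with
constant `√d L`. -/
theorem abs_sub_le_of_gradient_le (hD : Convex ℝ D) {h : EuclideanSpace ℝ (Fin d) → ℝ}
    {g : EuclideanSpace ℝ (Fin d) → EuclideanSpace ℝ (Fin d)} {L : ℝ} (hL : 0 ≤ L)
    (hg : ∀ x ∈ D, HasGradientWithinAt h (g x) D x) (hgL : ∀ x ∈ D, ∀ j, |g x j| ≤ L)
    {x y : EuclideanSpace ℝ (Fin d)} (hx : x ∈ D) (hy : y ∈ D) :
    |h y - h x| ≤ √d * L * ‖y - x‖ := by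
  refine hD.norm_image_sub_le_of_norm_hasFDerivWithin_le (𝕜 := ℝ)
    (fun z hz => (hg z hz).hasFDerivWithinAt) (fun z hz => ?_) hx hy
  rw [LinearIsometryEquiv.norm_map]
  exact norm_toLp_le hL (hgL z hz)

theorem norm_sub_le_of_mem_cube {r : ℝ} (hr : 0 ≤ r) {x y : EuclideanSpace ℝ (Fin d)}
    (hx : ∀ j, 0 ≤ x j ∧ x j ≤ r) (hy : ∀ j, 0 ≤ y j ∧ y j ≤ r) : ‖x - y‖ ≤ √d * r :=
  norm_toLp_le (v := fun j => x j - y j) hr fun j =>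
    abs_le.2 ⟨by linarith [(hx j).1, (hy j).2], by linarith [(hx j).2, (hy j).1]⟩

end Gradient

/-! ### Finite nets of convex subsets of the cube -/

section Net

/-- The centres of `N` equal pieces of `[0, r]` form an `r / (2 N)`-net. -/
theorem exists_abs_sub_center_le {r u : ℝ} (hr : 0 < r) {N : ℕ} (hN : 0 < N) (hu0 : 0 ≤ u)
    (hur : u ≤ r) : ∃ i : Fin N, |u - (2 * (i : ℕ) + 1) * (r / (2 * N))| ≤ r / (2 * N) := by
  have hN' : (0 : ℝ) < N := Nat.cast_pos.2 hN
  set h := r / (2 * N) with hh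
  have hh0 : 0 < h := by positivity
  have hr' : r = 2 * N * h := by rw [hh]; field_simp
  have hfl := Nat.floor_le (div_nonneg hu0 (by positivity : 0 ≤ 2 * h))
  have hlf := Nat.lt_floor_add_one (u / (2 * h))
  rw [le_div_iff₀ (by positivity)] at hfl
  rw [div_lt_iff₀ (by positivity)] at hlf
  rcases lt_or_ge ⌊u / (2 * h)⌋₊ N with hlt | hge
  · refine ⟨⟨_, hlt⟩, abs_le.2 ⟨?_, ?_⟩⟩ <;> dsimp only <;> linarith
  · have hcast : (N : ℝ) ≤ ⌊u / (2 * h)⌋₊ := by exact_mod_cast hge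
    refine ⟨⟨N - 1, by omega⟩, abs_le.2 ⟨?_, ?_⟩⟩ <;> dsimp only <;>
      rw [Nat.cast_pred hN] <;> nlinarith

/-- The metric projection onto a closed convex set does not increase distances to the set. -/
theorem exists_proj_norm_sub_le {F : Type*} [NormedAddCommGroup F] [InnerProductSpace ℝ F]
    {D : Set F} (hne : D.Nonempty) (hc : IsComplete D) (hconv : Convex ℝ D) (c : F) :
    ∃ v ∈ D, ∀ x ∈ D, ‖x - v‖ ≤ ‖x - c‖ := by
  obtain ⟨v, hv, hmin⟩ := exists_norm_eq_iInf_of_complete_convex hne hc hconv c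
  refine ⟨v, hv, fun x hx => ?_⟩
  have h := (norm_eq_iInf_iff_real_inner_le_zero hconv hv).1 hmin x hx
  have e : x - c = (x - v) - (c - v) := by abel
  have h2 := norm_sub_sq_real (x - v) (c - v)
  rw [← e, real_inner_comm] at h2
  refine le_of_sq_le_sq ?_ (norm_nonneg _)
  nlinarith [sq_nonneg ‖c - v‖]

/-- A closed convex subset of the cube `[0, r]^d` has a `√d r / (2 N)`-net of at most `N ^ d` of its
own points. -/
theorem exists_net {d : ℕ} {D : Set (EuclideanSpace ℝ (Fin d))} (hne : D.Nonempty)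
    (hc : IsComplete D) (hconv : Convex ℝ D) {r : ℝ} (hr : 0 < r)
    (hDr : ∀ x ∈ D, ∀ j, 0 ≤ x j ∧ x j ≤ r) {N : ℕ} (hN : 0 < N) :
    ∃ F : Finset D, F.card ≤ N ^ d ∧
      ∀ x ∈ D, ∃ z ∈ F, ‖x - z‖ ≤ √d * (r / (2 * N)) := by
  classical
  -- The centres of the small cubes may lie outside `D`, where the process is not controlled;
  -- projecting them onto `D` does not spoil the covering radius.
  choose π hπD hπ using exists_proj_norm_sub_le hne hc hconv
  let c : (Fin d → Fin N) → EuclideanSpace ℝ (Fin d) := fun i =>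
    WithLp.toLp 2 fun j => (2 * (i j : ℕ) + 1) * (r / (2 * N))
  refine ⟨Finset.univ.image fun i => (⟨π (c i), hπD _⟩ : D), ?_, fun x hx => ?_⟩
  · refine Finset.card_image_le.trans ?_
    simp
  · choose i hi using fun j => exists_abs_sub_center_le hr hN (hDr x hx j).1 (hDr x hx j).2
    refine ⟨_, Finset.mem_image_of_mem _ (Finset.mem_univ i), (hπ (c i) x hx).trans ?_⟩
    exact norm_toLp_le (v := fun j => x j - c i j) (by positivity) hi

end Net

/-! ### The exploration parameter and the union bound -/

section Beta

variable {d : ℕ} {a b r δ : ℝ} {t : ℕ}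

/-- The number of net points per coordinate that the exploration parameter `betaSeq` accounts
for. -/
def netScale (d : ℕ) (a b r δ : ℝ) (t : ℕ) : ℝ :=
  (t : ℝ) ^ 2 * d * b * r * √(Real.log (4 * d * a / δ))

theorem one_le_log_arg (ht : 1 ≤ t) (hδ0 : 0 < δ) (hδ1 : δ < 1) :
    1 ≤ 2 * (t : ℝ) ^ 2 * Real.pi ^ 2 / (3 * δ) := by
  have ht' : (1 : ℝ) ≤ t := by exact_mod_cast ht
  rw [le_div_iff₀ (by positivity)]
  have h1 : 1 ≤ (t : ℝ) ^ 2 := one_le_pow₀ ht'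
  have h2 : (9 : ℝ) ≤ Real.pi ^ 2 := by nlinarith [Real.pi_gt_three]
  nlinarith

theorem betaSeq_nonneg (ht : 1 ≤ t) (hδ0 : 0 < δ) (hδ1 : δ < 1) (hτ : 1 ≤ netScale d a b r δ t) :
    0 ≤ betaSeq d a b r δ t := by
  have h1 := Real.log_nonneg (one_le_log_arg ht hδ0 hδ1)
  have h2 := Real.log_nonneg hτ
  rw [netScale] at h2
  rw [betaSeq]
  positivity

theorem exp_neg_betaSeq (ht : 1 ≤ t) (hδ0 : 0 < δ) (hτ : 1 ≤ netScale d a b r δ t) :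
    Real.exp (-betaSeq d a b r δ t / 2) =
      3 * δ / (2 * (t : ℝ) ^ 2 * Real.pi ^ 2) * (netScale d a b r δ t ^ d)⁻¹ := by
  have ht' : (0 : ℝ) < t := by exact_mod_cast ht
  have hτ0 : 0 < netScale d a b r δ t := by linarith
  have e : -betaSeq d a b r δ t / 2 =
      -Real.log (2 * (t : ℝ) ^ 2 * Real.pi ^ 2 / (3 * δ)) +
        -Real.log (netScale d a b r δ t ^ d) := by
    rw [Real.log_pow, betaSeq, netScale]
    ring
  rw [e, Real.exp_add, Real.exp_neg, Real.exp_neg, Real.exp_log (by positivity),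
    Real.exp_log (by positivity), inv_div]

/-- The net points and the iterate account for at most `τ ^ d + 1 ≤ 2 τ ^ d` events, and `exp (-β_t
/ 2)` carries the factor `τ ^ (-d)`. The condition `1 ≤ τ` ensures `⌈τ / 2⌉ ≤ τ`. -/
theorem net_union_bound (ht : 1 ≤ t) (hδ0 : 0 < δ) (hτ : 1 ≤ netScale d a b r δ t) :
    ((⌈netScale d a b r δ t / 2⌉₊ : ℝ) ^ d + 1) * Real.exp (-betaSeq d a b r δ t / 2) ≤
      3 * δ / Real.pi ^ 2 * (1 / (t : ℝ) ^ 2) := by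
  have ht' : (0 : ℝ) < t := by exact_mod_cast ht
  rw [exp_neg_betaSeq ht hδ0 hτ]
  set τ := netScale d a b r δ t
  have hN : (⌈τ / 2⌉₊ : ℝ) ≤ τ := by
    rcases le_total τ 2 with h | h
    · have : ⌈τ / 2⌉₊ ≤ 1 := Nat.ceil_le.2 (by push_cast; linarith)
      exact (by exact_mod_cast this : (⌈τ / 2⌉₊ : ℝ) ≤ 1).trans hτ
    · have := Nat.ceil_lt_add_one (by linarith : 0 ≤ τ / 2)
      linarith
  have h1 : (⌈τ / 2⌉₊ : ℝ) ^ d ≤ τ ^ d := by gcongr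
  have h2 : 1 ≤ τ ^ d := one_le_pow₀ hτ
  have h0 : 0 < τ ^ d := by positivity
  calc _ ≤ (2 * τ ^ d) * (3 * δ / (2 * (t : ℝ) ^ 2 * Real.pi ^ 2) * (τ ^ d)⁻¹) := by
        refine mul_le_mul_of_nonneg_right (by linarith) (by positivity)
    _ = _ := by field_simp

end Beta

end

/-! ### The regret bound -/

/-- Regret bound for Bayesian optimization with a piecewise-linear approximation of the kernel:
`x t` solves the optimization model for the approximated LCB at iteration `t`, and the bound holds for
all iterations simultaneously on an event `A` of probability at least `1 - δ`. -/
theorem theorem4p4 {Ω : Type*} [MeasurableSpace Ω] (P : Measure Ω) [IsProbabilityMeasure P]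
    -- the domain
    (d : ℕ) (r : ℝ) (hr : 0 < r) (D : Set (EuclideanSpace ℝ (Fin d)))
    (hDc : IsCompact D) (hDconv : Convex ℝ D) (hDr : ∀ x ∈ D, ∀ j, 0 ≤ x j ∧ x j ≤ r)
    -- the radial kernel, its variance `k 0`, and an upper bound of the variance
    (k : ℝ → ℝ) (l : ℝ) (hl : 0 < l) (hk : ∀ ρ, 0 ≤ ρ → |k ρ| ≤ k 0)
    (σmax : ℝ) (hσmax : k 0 ≤ σmax ^ 2)
    -- the objective: a sample of the Gaussian process, with its gradient and an optimum
    (f : EuclideanSpace ℝ (Fin d) → Ω → ℝ) (hf : IsCenteredGP P D (radialKernel k l) f)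
    (g : Ω → EuclideanSpace ℝ (Fin d) → EuclideanSpace ℝ (Fin d))
    (hg : ∀ᵐ ω ∂P, ∀ x ∈ D, HasGradientWithinAt (fun z => f z ω) (g ω x) D x)
    (a b : ℝ) (ha : 0 < a) (hb : 0 < b)
    (htail : ∀ j : Fin d, ∀ L : ℝ, 0 < L →
      P {ω | ∃ x ∈ D, L < |g ω x j|} ≤ ENNReal.ofReal (a * Real.exp (-(L / b) ^ 2)))
    (xstar : Ω → EuclideanSpace ℝ (Fin d))
    (hxstar : ∀ᵐ ω ∂P, xstar ω ∈ D ∧ IsMinOn (fun z => f z ω) D (xstar ω))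
    (δ : ℝ) (hδ0 : 0 < δ) (hδ1 : δ < 1)
    -- the approximated kernel at iteration `t`: `M t` pieces, error at most `ε (M t)`
    (M : ℕ → ℕ) (R : (t : ℕ) → Fin (M t + 1) → ℝ) (hR : ∀ t, 1 ≤ t → StrictMono (R t))
    (hR0 : ∀ t, 1 ≤ t → R t 0 = 0)
    (hRlast : ∀ t, 1 ≤ t → ∀ x ∈ D, ∀ y ∈ D, ‖x - y‖ / l ≤ R t (Fin.last (M t)))
    (ε : ℕ → ℝ)
    (hε : ∀ t, 1 ≤ t → ∀ ρ ∈ Set.Icc 0 (R t (Fin.last (M t))),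
      |k ρ - pwlInterp k (R t) ρ| ≤ ε (M t))
    -- the iterates: measurable in the past observations, optimal for the approximated LCB
    (x : ℕ → Ω → EuclideanSpace ℝ (Fin d))
    (policy : (t : ℕ) → (Fin (t - 1) → ℝ) → EuclideanSpace ℝ (Fin d))
    (hpolicy : ∀ t, 1 ≤ t → Measurable (policy t))
    (hx : ∀ t, 1 ≤ t → ∀ ω, x t ω = policy t (pastValues f x t ω))
    (hxD : ∀ t, 1 ≤ t → ∀ ω, x t ω ∈ D)
    (hxopt : ∀ᵐ ω ∂P, ∀ t, 1 ≤ t →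
      IsLCBSolution D (pwlInterp k (R t)) l (betaSeq d a b r δ t)
        (pastPoints x t ω) (pastValues f x t ω) (x t ω)) :
    ∃ A : Set Ω, MeasurableSet A ∧ ENNReal.ofReal (1 - δ) ≤ P A ∧
      ∀ ω ∈ A, ∀ t : ℕ, 1 ≤ t →
        -- any `σε` that bounds the conditioning of the two Gram matrices
        ∀ σε : ℝ, 0 < σε →
        WellConditioned (radialKernel k l) (pastPoints x t ω) (σε ^ 2) →
        WellConditioned (radialKernel (pwlInterp k (R t)) l) (pastPoints x t ω) (σε ^ 2) →
        -- any bound `B` of the observations; `B = 1` for outputs scaled to `[0, 1]`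
        ∀ B : ℝ, 0 ≤ B → (∀ i, |pastValues f x t ω i| ≤ B) →
        ∀ Cμ Cσ : ℝ, Cμ = B * σmax ^ 2 / σε ^ 4 → Cσ = σmax ^ 2 / σε ^ 2 →
        f (x t ω) ω - f (xstar ω) ω ≤
          2 * Real.sqrt (betaSeq d a b r δ t) *
              postStd (radialKernel k l) (pastPoints x t ω) (x t ω)
            + 1 / (t : ℝ) ^ 2
            + 2 * Cμ * (t : ℝ) ^ 2 * ε (M t)
            + 4 * Cσ * Real.sqrt (betaSeq d a b r δ t) * t * Real.sqrt (ε (M t)) := by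
  classical
  obtain ⟨ω₀⟩ := P.nonempty_of_neZero
  have hne : D.Nonempty := ⟨x 1 ω₀, hxD 1 le_rfl ω₀⟩
  have hcomp : IsComplete D := hDc.isComplete
  obtain ⟨f', hf'm, hf'c, hf'f⟩ := exists_continuous_version (P := P)
    (f := fun (p : D) ω => f p ω) (fun p => hf.gaussian.aemeasurable p) (by
      filter_upwards [hg] with ω hω
      exact continuousOn_iff_continuous_domRestrict.1 fun z hz => (hω z hz).continuousWithinAt)
  have hf'ae : ∀ p : D, f p =ᵐ[P] f' p := fun p => hf'f.mono fun ω hω => (hω p).symm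
  have hG : IsGaussianProcess f' P := hf.gaussian.congr hf'ae
  have hmean : ∀ p, ∫ ω, f' p ω ∂P = 0 := fun p =>
    (integral_congr_ae (hf'ae p)).symm.trans (hf.mean_eq_zero p p.2)
  let κ : D → D → ℝ := fun p q => radialKernel k l p.1 q.1
  have hcov : ∀ p q, cov[f' p, f' q; P] = κ p q := fun p q => by
    rw [← covariance_congr_ae (hf'ae p) (hf'ae q)]
    exact hf.cov_eq p p.2 q q.2
  -- Iteration `t` is position `t - 1` of the design. The policy is known to land in `D` only on
  -- histories that occur, so other values are replaced by a fixed point of `D`.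
  let π : (j : ℕ) → (Fin j → ℝ) → D := fun j y =>
    ⟨if policy (j + 1) y ∈ D then policy (j + 1) y else hne.some, by
      split_ifs with h
      exacts [h, hne.some_mem]⟩
  have hπ : ∀ j, Measurable (π j) := fun j => by
    have hpj : Measurable (policy (j + 1)) := hpolicy (j + 1) (by omega)
    exact (Measurable.ite (hpj hDc.isClosed.measurableSet) hpj measurable_const).subtype_mk
  let X := adaptiveDesign f' π
  have htrack : ∀ ω, (∀ p : D, f' p ω = f p ω) → ∀ j, x (j + 1) ω = X ω j := by
    intro ω hω j
    induction j using Nat.strong_induction_on with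
    | _ j ih =>
      have hpast : pastValues f x (j + 1) ω = designOutputs f' j (X ω) ω := by
        funext i
        change f (x (i + 1) ω) ω = f' (X ω i) ω
        rw [hω, ih i i.2]
      have hxj := hx (j + 1) (by omega) ω
      rw [hpast] at hxj
      have hmem := hxD (j + 1) (by omega) ω
      rw [hxj] at hmem ⊢
      have hXj : X ω j = π j (designOutputs f' j (X ω) ω) := adaptiveDesign_eq f' π ω j
      rw [hXj]
      exact (if_pos hmem).symm
  let τ : ℕ → ℝ := netScale d a b r δ
  -- With `⌈τ / 2⌉` pieces per coordinate the covering radius is at most `√d r / τ`; times the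
  -- Lipschitz constant `√d L` this is `d L r / τ = 1 / t²`.
  have hnet : ∀ t, ∃ F : Finset D, 1 ≤ τ t → F.card ≤ ⌈τ t / 2⌉₊ ^ d ∧
      ∀ z ∈ D, ∃ w ∈ F, ‖z - w‖ ≤ √d * (r / (2 * ⌈τ t / 2⌉₊)) := by
    intro t
    by_cases h : 1 ≤ τ t
    · obtain ⟨F, hF⟩ := exists_net hne hcomp hDconv hr hDr (N := ⌈τ t / 2⌉₊)
        (Nat.ceil_pos.2 (by linarith))
      exact ⟨F, fun _ => hF⟩
    · exact ⟨∅, fun h' => absurd h' h⟩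
  choose F hF using hnet
  let c : ℕ → ℝ := fun t => √(betaSeq d a b r δ t)
  let up : ℕ → Set Ω := fun t => {ω | ¬ ConfidenceBound κ (fun j : Fin (t - 1) => X ω j)
    (designOutputs f' (t - 1) (X ω) ω) (π (t - 1) (designOutputs f' (t - 1) (X ω) ω))
    (f' (π (t - 1) (designOutputs f' (t - 1) (X ω) ω)) ω) 1 (c t)}
  let low : ℕ → D → Set Ω := fun t z => {ω | ¬ ConfidenceBound κ (fun j : Fin (t - 1) => X ω j)
    (designOutputs f' (t - 1) (X ω) ω) z (f' z ω) (-1) (c t)}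
  let bad : ℕ → Set Ω := fun t =>
    if 1 ≤ t ∧ 1 ≤ τ t then (⋃ z ∈ F t, low t z) ∪ up t else ∅
  have hbad : ∀ t, P (bad t) ≤ ENNReal.ofReal (3 * δ / Real.pi ^ 2 * (1 / (t : ℝ) ^ 2)) := by
    intro t
    by_cases h : 1 ≤ t ∧ 1 ≤ τ t
    · have hc2 : -c t ^ 2 / 2 = -betaSeq d a b r δ t / 2 := by
        simp only [c, Real.sq_sqrt (betaSeq_nonneg h.1 hδ0 hδ1 h.2)]
      have hup : P (up t) ≤ ENNReal.ofReal (Real.exp (-betaSeq d a b r δ t / 2)) := by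
        rw [← hc2]
        exact measure_not_confidence_le hf'm hf'c hG hmean hcov hπ (hπ (t - 1)) (by norm_num)
          (Real.sqrt_nonneg _)
      have hlow : ∀ z, P (low t z) ≤
          ENNReal.ofReal (Real.exp (-betaSeq d a b r δ t / 2)) := fun z => by
        rw [← hc2]
        exact measure_not_confidence_le hf'm hf'c hG hmean hcov hπ
          (ζ := fun _ => z) measurable_const (by norm_num) (Real.sqrt_nonneg _)
      simp only [bad, if_pos h]
      calc P ((⋃ z ∈ F t, low t z) ∪ up t)
          ≤ ∑ z ∈ F t, P (low t z) + P (up t) :=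
            (measure_union_le _ _).trans (add_le_add (measure_biUnion_finset_le _ _) le_rfl)
        _ ≤ ∑ z ∈ F t, ENNReal.ofReal (Real.exp (-betaSeq d a b r δ t / 2)) +
            ENNReal.ofReal (Real.exp (-betaSeq d a b r δ t / 2)) :=
            add_le_add (Finset.sum_le_sum fun z _ => hlow z) hup
        _ = ENNReal.ofReal (((F t).card + 1) * Real.exp (-betaSeq d a b r δ t / 2)) := by
            rw [Finset.sum_const, nsmul_eq_mul, add_mul, one_mul,
              ENNReal.ofReal_add (by positivity) (by positivity),
              ENNReal.ofReal_mul (Nat.cast_nonneg _), ENNReal.ofReal_natCast]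
        _ ≤ _ := by
            refine ENNReal.ofReal_le_ofReal (le_trans ?_ (net_union_bound h.1 hδ0 h.2))
            refine mul_le_mul_of_nonneg_right ?_ (Real.exp_pos _).le
            have : ((F t).card : ℝ) ≤ (⌈τ t / 2⌉₊ : ℝ) ^ d := by exact_mod_cast (hF t h.2).1
            linarith
    · simp only [bad, if_neg h, measure_empty]
      exact bot_le
  have hbadU : P (⋃ t, bad t) ≤ ENNReal.ofReal (δ / 2) := by
    -- The series starts at `t = 0`, where `bad 0` is empty and `1 / 0 = 0`; its sum `π² / 6` gives
    -- `δ / 2`.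
    have hsum := hasSum_zeta_two.mul_left (3 * δ / Real.pi ^ 2)
    calc P (⋃ t, bad t) ≤ ∑' t, P (bad t) := measure_iUnion_le _
      _ ≤ ∑' t : ℕ, ENNReal.ofReal (3 * δ / Real.pi ^ 2 * (1 / (t : ℝ) ^ 2)) :=
          ENNReal.tsum_le_tsum hbad
      _ = ENNReal.ofReal (∑' t : ℕ, 3 * δ / Real.pi ^ 2 * (1 / (t : ℝ) ^ 2)) :=
          (ENNReal.ofReal_tsum_of_nonneg (fun t => by positivity) hsum.summable).symm
      _ = ENNReal.ofReal (δ / 2) := by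
          rw [hsum.tsum_eq]
          congr 1
          field_simp
          norm_num
  set L := b * √(Real.log (4 * d * a / δ)) with hL
  have hL0 : 0 ≤ L := by positivity
  let steep : Set Ω := {ω | ∃ j, ∃ z ∈ D, L < |g ω z j|}
  have hsteep : P steep ≤ ENNReal.ofReal (δ / 4) := measure_gradient_gt_le ha hb hδ0 htail
  let good : Ω → Prop := fun ω => (∀ z ∈ D, HasGradientWithinAt (fun z => f z ω) (g ω z) D z) ∧
    (xstar ω ∈ D ∧ IsMinOn (fun z => f z ω) D (xstar ω)) ∧ (∀ p : D, f' p ω = f p ω) ∧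
    ∀ t, 1 ≤ t → IsLCBSolution D (pwlInterp k (R t)) l (betaSeq d a b r δ t)
      (pastPoints x t ω) (pastValues f x t ω) (x t ω)
  have hgood : P {ω | ¬ good ω} = 0 :=
    ae_iff.1 (hg.and (hxstar.and (hf'f.and hxopt)))
  let fail : Set Ω := ((⋃ t, bad t) ∪ steep) ∪ {ω | ¬ good ω}
  have hfail : P fail ≤ ENNReal.ofReal δ := by
    calc P fail ≤ (P (⋃ t, bad t) + P steep) + P {ω | ¬ good ω} :=
          (measure_union_le _ _).trans (add_le_add (measure_union_le _ _) le_rfl)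
      _ ≤ (ENNReal.ofReal (δ / 2) + ENNReal.ofReal (δ / 4)) + 0 :=
          add_le_add (add_le_add hbadU hsteep) hgood.le
      _ = ENNReal.ofReal (δ / 2 + δ / 4) := by
          rw [add_zero, ENNReal.ofReal_add (by positivity) (by positivity)]
      _ ≤ ENNReal.ofReal δ := ENNReal.ofReal_le_ofReal (by linarith)
  -- `fail` need not be measurable, since `steep` is an uncountable union, so a measurable hull of
  -- the same measure is removed.
  refine ⟨(toMeasurable P fail)ᶜ, (measurableSet_toMeasurable P fail).compl, ?_, ?_⟩
  · rw [prob_compl_eq_one_sub (measurableSet_toMeasurable P fail), measure_toMeasurable,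
      ENNReal.ofReal_sub _ hδ0.le, ENNReal.ofReal_one]
    exact tsub_le_tsub_left hfail 1
  intro ω hω t ht σε hσε hK hK' B hB hy Cμ Cσ hCμ hCσ
  have hωf : ω ∉ fail := fun h => hω (subset_toMeasurable P fail h)
  have hωbad : ∀ t, ω ∉ bad t := fun t h => hωf (Or.inl (Or.inl (Set.mem_iUnion.2 ⟨t, h⟩)))
  have hωg : good ω := by
    by_contra h
    exact hωf (Or.inr h)
  have hωL : ∀ z ∈ D, ∀ j, |g ω z j| ≤ L := fun z hz j => by
    by_contra h
    exact hωf (Or.inl (Or.inr ⟨j, z, hz, not_le.1 h⟩))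
  obtain ⟨hgrad, ⟨hsD, hsmin⟩, hff, hopt⟩ := hωg
  have ht0 : (0 : ℝ) < t := by exact_mod_cast ht
  have hlip : ∀ z ∈ D, ∀ w ∈ D, f z ω - f w ω ≤ √d * L * ‖z - w‖ := fun z hz w hw =>
    (le_abs_self _).trans (abs_sub_le_of_gradient_le hDconv hL0 hgrad hωL hw hz)
  have hτL : τ t = (t : ℝ) ^ 2 * (d * L * r) := by
    simp only [τ, netScale, hL]
    ring
  have hsqd : √(d : ℝ) * √d = d := Real.mul_self_sqrt (Nat.cast_nonneg d)
  have hε0 : 0 ≤ ε (M t) := (abs_nonneg _).trans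
    (hε t ht 0 ⟨le_rfl, hR0 t ht ▸ (hR t ht).monotone (Fin.zero_le _)⟩)
  have hxt := hxD t ht ω
  rcases lt_or_ge (τ t) 1 with hτ | hτ
  · have h1 : f (x t ω) ω - f (xstar ω) ω ≤ 1 / (t : ℝ) ^ 2 := by
      refine (hlip _ hxt _ hsD).trans ?_
      have h2 := norm_sub_le_of_mem_cube hr.le (hDr _ hxt) (hDr _ hsD)
      calc √d * L * ‖x t ω - xstar ω‖ ≤ √d * L * (√d * r) := by gcongr
        _ = (√d * √d) * L * r := by ring
        _ = d * L * r := by rw [hsqd]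
        _ ≤ 1 / (t : ℝ) ^ 2 := by
          rw [le_div_iff₀ (by positivity), mul_comm, ← hτL]
          exact hτ.le
    have h3 : 0 ≤ postStd (radialKernel k l) (pastPoints x t ω) (x t ω) := Real.sqrt_nonneg _
    have h4 : 0 ≤ Cμ := hCμ ▸ by positivity
    have h5 : 0 ≤ Cσ := hCσ ▸ by positivity
    have h6 : 0 ≤ 2 * √(betaSeq d a b r δ t) *
        postStd (radialKernel k l) (pastPoints x t ω) (x t ω) := by positivity
    have h7 : 0 ≤ 2 * Cμ * (t : ℝ) ^ 2 * ε (M t) := by positivity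
    have h8 : 0 ≤ 4 * Cσ * √(betaSeq d a b r δ t) * t * √(ε (M t)) := by positivity
    linarith
  obtain ⟨n, rfl⟩ : ∃ n, t = n + 1 := ⟨t - 1, by omega⟩
  obtain ⟨z, hzF, hz⟩ := (hF (n + 1) hτ).2 _ hsD
  have hmemb : ω ∉ (⋃ z ∈ F (n + 1), low (n + 1) z) ∪ up (n + 1) := by
    have := hωbad (n + 1)
    simp only [bad, if_pos (And.intro ht hτ)] at this
    exact this
  have hXe : (fun j : Fin n => (X ω j : EuclideanSpace ℝ (Fin d))) = pastPoints x (n + 1) ω :=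
    funext fun j => (htrack ω hff j).symm
  have hye : designOutputs f' n (X ω) ω = pastValues f x (n + 1) ω := by
    funext j
    change f' (X ω j) ω = f (x (j + 1) ω) ω
    rw [hff, htrack ω hff]
  have hxe : ((π n (designOutputs f' n (X ω) ω) : D) : EuclideanSpace ℝ (Fin d)) =
      x (n + 1) ω := by
    rw [htrack ω hff]
    exact congrArg _ (adaptiveDesign_eq f' π ω n).symm
  have hdet : IsUnit (gramMatrix κ fun j : Fin n => X ω j).det := by
    have := hK.1
    rw [← hXe] at this
    exact this
  have hup : ConfidenceBound κ (fun j : Fin n => X ω j)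
      (designOutputs f' n (X ω) ω) (π n (designOutputs f' n (X ω) ω))
      (f' (π n (designOutputs f' n (X ω) ω)) ω) 1 (c (n + 1)) := by
    by_contra h
    exact hmemb (Or.inr h)
  have hlow : ConfidenceBound κ (fun j : Fin n => X ω j)
      (designOutputs f' n (X ω) ω) z (f' z ω) (-1) (c (n + 1)) := by
    by_contra h
    exact hmemb (Or.inl (Set.mem_biUnion hzF h))
  have hup' : f (x (n + 1) ω) ω -
      postMean (radialKernel k l) (pastPoints x (n + 1) ω) (pastValues f x (n + 1) ω)
        (x (n + 1) ω) ≤ c (n + 1) *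
      postStd (radialKernel k l) (pastPoints x (n + 1) ω) (x (n + 1) ω) := by
    have h := hup hdet
    rw [one_mul, hff, hye] at h
    rw [← hXe, ← hxe, hye]
    exact h
  have hlow' : postMean (radialKernel k l) (pastPoints x (n + 1) ω) (pastValues f x (n + 1) ω) z -
      f z ω ≤ c (n + 1) * postStd (radialKernel k l) (pastPoints x (n + 1) ω) z := by
    have h := hlow hdet
    rw [neg_one_mul, neg_sub, hff, hye] at h
    rw [← hXe]
    exact h
  have hpos : (gramMatrix (radialKernel k l) (pastPoints x (n + 1) ω)).PosSemidef := by
    rw [← hXe]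
    exact posSemidef_gramMatrix hG hcov fun j : Fin n => X ω j
  -- The comparison point is the net point `z`, not the minimizer; `hdisc` pays for the difference.
  have hmain := IsLCBSolution.sub_le (hR _ ht) (hR0 _ ht) (hRlast _ ht) (hε _ ht) hk hσmax hl
    (hopt _ ht) (fun i => hxD _ (by omega) ω) hxt hpos hσε hK hK' hB hy z.2 hup' hlow'
  have hdisc : f z ω - f (xstar ω) ω ≤ 1 / ((n + 1 : ℕ) : ℝ) ^ 2 := by
    refine (hlip _ z.2 _ hsD).trans ?_
    have hN : τ (n + 1) / 2 ≤ ⌈τ (n + 1) / 2⌉₊ := Nat.le_ceil _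
    have hN0 : (0 : ℝ) < ⌈τ (n + 1) / 2⌉₊ := by linarith
    rw [norm_sub_rev] at hz
    calc √d * L * ‖(z : EuclideanSpace ℝ (Fin d)) - xstar ω‖
        ≤ √d * L * (√d * (r / (2 * ⌈τ (n + 1) / 2⌉₊))) := by gcongr
      _ = (√d * √d) * L * r / (2 * ⌈τ (n + 1) / 2⌉₊) := by ring
      _ = d * L * r / (2 * ⌈τ (n + 1) / 2⌉₊) := by rw [hsqd]
      _ ≤ 1 / ((n + 1 : ℕ) : ℝ) ^ 2 := by
        rw [div_le_div_iff₀ (by positivity) (by positivity), one_mul, mul_comm, ← hτL]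
        linarith
  rw [hCμ, hCσ]
  have e1 : ((n + 1 - 1 : ℕ) : ℝ) + 1 = ((n + 1 : ℕ) : ℝ) := by push_cast; simp
  rw [e1] at hmain
  linarith
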